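/- **Theorem.** Let $\mathsf{Q}=\overline{U}_{\mathrm{i}}\,s\ell(2)$ be the restricted quantum group at $\mathfrak q=\mathrm i$, i.e. the $\mathbb C$-algebra generated by $\mathsf E,\mathsf F,\mathsf K^{\pm1}$ with relations $$\mathsf K\mathsf E\mathsf K^{-1}=-\mathsf E,\quad \mathsf K\mathsf F\mathsf K^{-1}=-\mathsf F,\quad [\mathsf E,\mathsf F]=\frac{\mathsf K-\mathsf K^{-1}}{2\mathrm i},\quad \mathsf E^2=\mathsf F^2=0,\quad \mathsf K^4=\boldsymbol 1,$$ with its usual Hopf algebra structure $$\Delta(\mathsf E)=\boldsymbol 1\otimes\mathsf E+\mathsf E\otimes\mathsf K,\quad \Delta(\mathsf F)=\mathsf K^{-1}\otimes\mathsf F+\mathsf F\otimes\boldsymbol 1,\quad \Delta(\mathsf K)=\mathsf K\otimes\mathsf K,$$ $$\epsilon(\mathsf E)=\epsilon(\mathsf F)=0,\quad \epsilon(\mathsf K)=1,\quad S(\mathsf E)=-\mathsf E\mathsf K^{-1},\quad S(\mathsf F)=-\mathsf K\mathsf F,\quad S(\mathsf K)=\mathsf K^{-1}.$$ Put $\boldsymbol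 e_0=\frac12(\boldsymbol 1+\mathsf K^2)$, $\boldsymbol e_1=\frac12(\boldsymbol 1-\mathsf K^2)$, $\boldsymbol C=\mathsf F\mathsf E-\frac{\mathrm i}{4}(\mathsf K-\mathsf K^{-1})$, and let $\beta\in\mathbb C$ with $\beta^4=-1$. Define $\Phi\in\mathsf Q^{\otimes 3}$ by $$\Phi=\boldsymbol e_0\otimes\boldsymbol e_0\otimes\boldsymbol e_0+\boldsymbol e_1\otimes\boldsymbol e_0\otimes\boldsymbol e_0+\Phi^{010}\,\boldsymbol e_0\otimes\boldsymbol e_1\otimes\boldsymbol e_0+\boldsymbol e_0\otimes\boldsymbol e_0\otimes\boldsymbol e_1+\boldsymbol e_1\otimes\boldsymbol e_1\otimes\boldsymbol e_0+\Phi^{101}\,\boldsymbol e_1\otimes\boldsymbol e_0\otimes\boldsymbol e_1+\boldsymbol e_0\otimes\boldsymbol e_1\otimes\boldsymbol e_1+\Phi^{111}\,\boldsymbol e_1\otimes\boldsymbol e_1\otimes\boldsymbol e_1,$$ where $$\begin{aligned} \Phi^{010}={}&\boldsymbol 1\otimes\boldsymbol 1\otimes\boldsymbol 1-(1+\mathrm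 i)\mathsf E\otimes\mathsf K\otimes\mathsf F+(1-\mathrm i)\mathsf F\mathsf K\otimes\mathsf K\otimes\mathsf E\mathsf K+2\,\mathsf E\mathsf F\mathsf K\otimes\boldsymbol 1\otimes\mathsf E\mathsf F\mathsf K,\\ \Phi^{101}={}&(\mathrm i-1)\boldsymbol 1\otimes\mathsf F\otimes\mathsf E\mathsf K+\boldsymbol 1\otimes\mathsf K\otimes\boldsymbol 1+2\,\boldsymbol 1\otimes\mathsf E\mathsf F\otimes\mathsf E\mathsf F\mathsf K-(1+\mathrm i)\boldsymbol 1\otimes\mathsf E\mathsf K\otimes\mathsf F\\ &-(1+\mathrm i)\mathsf E\otimes\mathsf F\mathsf K\otimes\boldsymbol 1+2\mathrm i\,\mathsf E\otimes\mathsf E\mathsf F\mathsf K\otimes\mathsf F+(1-\mathrm i)\mathsf F\mathsf K\otimes\mathsf E\otimes\boldsymbol 1\\ &-2\mathrm i\,\mathsf F\mathsf K\otimes\mathsf E\mathsf F\mathsf K\otimes\mathsf E\mathsf K-2\,\mathsf E\mathsf F\mathsf K\otimes\mathsf E\mathsf F\otimes\boldsymbol 1,\\ \Phi^{111}={}&\mathrm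 i\beta^2\bigl\{(1+\mathrm i)\boldsymbol 1\otimes\mathsf F\otimes\mathsf E\mathsf K-\boldsymbol 1\otimes\mathsf K\otimes\boldsymbol 1-2\,\boldsymbol 1\otimes\mathsf E\mathsf F\otimes\boldsymbol 1-2\mathrm i\,\boldsymbol 1\otimes\mathsf E\mathsf F\otimes\mathsf E\mathsf F\mathsf K\\ &+(1+\mathrm i)\boldsymbol 1\otimes\mathsf E\mathsf K\otimes\mathsf F-(1+\mathrm i)\mathsf E\otimes\boldsymbol 1\otimes\mathsf F+(1+\mathrm i)\mathsf E\otimes\mathsf F\mathsf K\otimes\boldsymbol 1+2\mathrm i\,\mathsf E\otimes\mathsf F\mathsf K\otimes\mathsf E\mathsf F\mathsf K\\ &+2\,\mathsf E\otimes\mathsf E\mathsf F\mathsf K\otimes\mathsf F-(1+\mathrm i)\mathsf F\mathsf K\otimes\boldsymbol 1\otimes\mathsf E\mathsf K+(1+\mathrm i)\mathsf F\mathsf K\otimes\mathsf E\otimes\boldsymbol 1+2\mathrm i\,\mathsf F\mathsf K\otimes\mathsf E\otimes\mathsf E\mathsf F\mathsf K\\ &+2\,\mathsf F\mathsf K\otimes\mathsf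 E\mathsf F\mathsf K\otimes\mathsf E\mathsf K+2\mathrm i\,\mathsf E\mathsf F\mathsf K\otimes\mathsf F\otimes\mathsf E\mathsf K+2\mathrm i\,\mathsf E\mathsf F\mathsf K\otimes\mathsf K\otimes\mathsf E\mathsf F\mathsf K-2\mathrm i\,\mathsf E\mathsf F\mathsf K\otimes\mathsf E\mathsf F\otimes\boldsymbol 1\\ &+2\mathrm i\,\mathsf E\mathsf F\mathsf K\otimes\mathsf E\mathsf K\otimes\mathsf F+4\,\mathsf E\mathsf F\mathsf K\otimes\mathsf E\mathsf F\otimes\mathsf E\mathsf F\mathsf K\bigr\}, \end{aligned}$$ and define $R\in\mathsf Q^{\otimes2}$ by $R=R^{00}\,\boldsymbol e_0\otimes\boldsymbol e_0+R^{01}\,\boldsymbol e_0\otimes\boldsymbol e_1+R^{10}\,\boldsymbol e_1\otimes\boldsymbol e_0+R^{11}\,\boldsymbol e_1\otimes\boldsymbol e_1$ with $$\begin{aligned} R^{00}={}&\tfrac12(\boldsymbol 1\otimes\boldsymbol 1+\boldsymbol 1\otimes\mathsf K+\mathsf K\otimes\boldsymbol 1-\mathsf K\otimes\mathsf K)\{\boldsymbol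 1\otimes\boldsymbol 1+2\mathrm i\,\mathsf E\otimes\mathsf F\},\\ R^{01}={}&\tfrac12(\boldsymbol 1\otimes\boldsymbol 1-\mathrm i\,\boldsymbol 1\otimes\mathsf K+\mathsf K\otimes\boldsymbol 1+\mathrm i\,\mathsf K\otimes\mathsf K)\{\boldsymbol 1\otimes\boldsymbol 1+(1-\mathrm i)\mathsf F\mathsf K\otimes\mathsf E\mathsf K\\ &-(1-\mathrm i)\mathsf E\otimes\mathsf F+(1+\mathrm i)\mathsf E\mathsf F\mathsf K\otimes\boldsymbol 1+2\mathrm i\,\mathsf E\mathsf F\mathsf K\otimes\mathsf E\mathsf F\mathsf K\},\\ R^{10}={}&\tfrac12(\boldsymbol 1\otimes\boldsymbol 1+\boldsymbol 1\otimes\mathsf K-\mathrm i\,\mathsf K\otimes\boldsymbol 1+\mathrm i\,\mathsf K\otimes\mathsf K)\{\boldsymbol 1\otimes\mathsf K+(1-\mathrm i)\mathsf F\mathsf K\otimes\mathsf E\\ &+(1-\mathrm i)\mathsf E\otimes\mathsf F\mathsf K-(1-\mathrm i)\boldsymbol 1\otimes\mathsf E\mathsf F-2\mathrm i\,\mathsf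 E\mathsf F\mathsf K\otimes\mathsf E\mathsf F\},\\ R^{11}={}&\tfrac{\beta}{2}(\boldsymbol 1\otimes\boldsymbol 1-\mathrm i\,\boldsymbol 1\otimes\mathsf K-\mathrm i\,\mathsf K\otimes\boldsymbol 1+\mathsf K\otimes\mathsf K)\{-\mathrm i\,\mathsf K\otimes\boldsymbol 1+2\mathrm i\,\mathsf E\mathsf K\otimes\mathsf F\\ &+(1-\mathrm i)\mathsf K\otimes\mathsf E\mathsf F\mathsf K-(1+\mathrm i)\mathsf E\mathsf F\otimes\boldsymbol 1-2\mathrm i\,\mathsf E\mathsf F\otimes\mathsf E\mathsf F\mathsf K\}. \end{aligned}$$ Finally let $\boldsymbol\alpha=\boldsymbol 1$ and $\boldsymbol\beta=\boldsymbol e_0-2\mathrm i\beta^2\boldsymbol C\boldsymbol e_1$. Then $\mathsf Q$, with the algebra structure and $\Delta,\epsilon,S$ as above, is a quasi-triangular quasi-Hopf algebra with coassociator $\Phi$, R-matrix $R$, evaluation element $\boldsymbol\alpha$ and coevaluation element $\boldsymbol\beta$. That is: $\Delta,\epsilon$ are algebra homomorphisms with $(\epsilon\otimes\mathrm{id})\Delta=\mathrm{id}=(\mathrm{id}\otimes\epsilon)\Delta$;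 $S$ is an algebra anti-homomorphism; $\Phi$ and $R$ are invertible; for all $a\in\mathsf Q$ $$(\Delta\otimes\mathrm{id})(\Delta(a))=\Phi\,\bigl((\mathrm{id}\otimes\Delta)(\Delta(a))\bigr)\,\Phi^{-1},\qquad R\,\Delta(a)=\Delta^{\mathrm{op}}(a)\,R;$$ $(\mathrm{id}\otimes\epsilon\otimes\mathrm{id})(\Phi)=\boldsymbol 1\otimes\boldsymbol 1$ and $$(\Delta\otimes\mathrm{id}\otimes\mathrm{id})(\Phi)\cdot(\mathrm{id}\otimes\mathrm{id}\otimes\Delta)(\Phi)=(\Phi\otimes\boldsymbol 1)\cdot(\mathrm{id}\otimes\Delta\otimes\mathrm{id})(\Phi)\cdot(\boldsymbol 1\otimes\Phi);$$ $$(\Delta\otimes\mathrm{id})(R)=\Phi_{231}^{-1}R_{13}\Phi_{132}R_{23}\Phi^{-1},\qquad(\mathrm{id}\otimes\Delta)(R)=\Phi_{312}R_{13}\Phi_{213}^{-1}R_{12}\Phi,$$ where for $\Phi=\sum\Phi'\otimes\Phi''\otimes\Phi'''$ one sets $\Phi_{231}=\sum\Phi''\otimes\Phi'''\otimes\Phi'$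 etc.; and, for all $a\in\mathsf Q$, $$\sum S(a')\boldsymbol\alpha a''=\epsilon(a)\boldsymbol\alpha,\quad\sum a'\boldsymbol\beta S(a'')=\epsilon(a)\boldsymbol\beta,\quad\sum S(\Phi')\boldsymbol\alpha\Phi''\boldsymbol\beta S(\Phi''')=\boldsymbol 1,\quad\sum(\Phi^{-1})'\boldsymbol\beta S((\Phi^{-1})'')\boldsymbol\alpha(\Phi^{-1})'''=\boldsymbol 1.$$ Moreover, $R^{00}$ equals the standard R-matrix $R^{\mathrm{st}}=\frac12\sum_{m,n=0,1}(-1)^{mn}\mathsf K^m\otimes\mathsf K^n(\boldsymbol 1\otimes\boldsymbol 1+2\mathrm i\,\mathsf E\otimes\mathsf F)$, so that $R\cdot(\boldsymbol e_0\otimes\boldsymbol e_0)=R^{\mathrm{st}}\cdot(\boldsymbol e_0\otimes\boldsymbol e_0)$. -/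

import Mathlib

open scoped TensorProduct

noncomputable section

/-! Quasi-triangular quasi-Hopf algebras over the complex numbers (with trivial unit
isomorphisms).  Threefold and fourfold tensor powers are bracketed to the right. -/

namespace QuasiHopf

variable (A : Type) [Ring A] [Algebra ℂ A]

/-- The threefold tensor power of `A`. -/
abbrev T3 : Type := A ⊗[ℂ] (A ⊗[ℂ] A)

/-- The fourfold tensor power of `A`. -/
abbrev T4 : Type := A ⊗[ℂ] (A ⊗[ℂ] (A ⊗[ℂ] A))

variable {A}

/-- `Δ ⊗ id : A ⊗ A → A ⊗ A ⊗ A`. -/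
def comulId (Δ : A →ₐ[ℂ] A ⊗[ℂ] A) : A ⊗[ℂ] A →ₐ[ℂ] T3 A :=
  (Algebra.TensorProduct.assoc ℂ ℂ ℂ A A A).toAlgHom.comp
    (Algebra.TensorProduct.map Δ (AlgHom.id ℂ A))

/-- `id ⊗ Δ : A ⊗ A → A ⊗ A ⊗ A`. -/
def idComul (Δ : A →ₐ[ℂ] A ⊗[ℂ] A) : A ⊗[ℂ] A →ₐ[ℂ] T3 A :=
  Algebra.TensorProduct.map (AlgHom.id ℂ A) Δ

/-- `Δ ⊗ id ⊗ id : A ⊗ A ⊗ A → A ⊗ A ⊗ A ⊗ A`. -/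
def comulIdId (Δ : A →ₐ[ℂ] A ⊗[ℂ] A) : T3 A →ₐ[ℂ] T4 A :=
  (Algebra.TensorProduct.assoc ℂ ℂ ℂ A A (A ⊗[ℂ] A)).toAlgHom.comp
    (Algebra.TensorProduct.map Δ (AlgHom.id ℂ (A ⊗[ℂ] A)))

/-- `id ⊗ Δ ⊗ id : A ⊗ A ⊗ A → A ⊗ A ⊗ A ⊗ A`. -/
def idComulId (Δ : A →ₐ[ℂ] A ⊗[ℂ] A) : T3 A →ₐ[ℂ] T4 A :=
  Algebra.TensorProduct.map (AlgHom.id ℂ A) (comulId Δ)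

/-- `id ⊗ id ⊗ Δ : A ⊗ A ⊗ A → A ⊗ A ⊗ A ⊗ A`. -/
def idIdComul (Δ : A →ₐ[ℂ] A ⊗[ℂ] A) : T3 A →ₐ[ℂ] T4 A :=
  Algebra.TensorProduct.map (AlgHom.id ℂ A) (idComul Δ)

/-- `X ↦ X ⊗ 1`, from `A ⊗ A ⊗ A` to `A ⊗ A ⊗ A ⊗ A`. -/
def tensorOne : T3 A →ₐ[ℂ] T4 A :=
  Algebra.TensorProduct.map (AlgHom.id ℂ A)
    (Algebra.TensorProduct.map (AlgHom.id ℂ A) Algebra.TensorProduct.includeLeft)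

/-- `X ↦ 1 ⊗ X`, from `A ⊗ A ⊗ A` to `A ⊗ A ⊗ A ⊗ A`. -/
def oneTensor : T3 A →ₐ[ℂ] T4 A :=
  Algebra.TensorProduct.includeRight

/-- `id ⊗ ε ⊗ id : A ⊗ A ⊗ A → A ⊗ A`. -/
def idCounitId (ε : A →ₐ[ℂ] ℂ) : T3 A →ₐ[ℂ] A ⊗[ℂ] A :=
  Algebra.TensorProduct.map (AlgHom.id ℂ A)
    ((Algebra.TensorProduct.lid ℂ A).toAlgHom.comp
      (Algebra.TensorProduct.map ε (AlgHom.id ℂ A)))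

/-- `x ⊗ y ↦ x ⊗ y ⊗ 1`. -/
def leg12 : A ⊗[ℂ] A →ₐ[ℂ] T3 A :=
  Algebra.TensorProduct.map (AlgHom.id ℂ A) Algebra.TensorProduct.includeLeft

/-- `x ⊗ y ↦ x ⊗ 1 ⊗ y`. -/
def leg13 : A ⊗[ℂ] A →ₐ[ℂ] T3 A :=
  Algebra.TensorProduct.map (AlgHom.id ℂ A) Algebra.TensorProduct.includeRight

/-- `x ⊗ y ↦ 1 ⊗ x ⊗ y`. -/
def leg23 : A ⊗[ℂ] A →ₐ[ℂ] T3 A :=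
  Algebra.TensorProduct.includeRight

/-- `x ⊗ y ↦ y ⊗ x`. -/
def flip : A ⊗[ℂ] A →ₐ[ℂ] A ⊗[ℂ] A :=
  (Algebra.TensorProduct.comm ℂ A A).toAlgHom

/-- `x ⊗ y ⊗ z ↦ x ⊗ z ⊗ y`. -/
def perm132 : T3 A →ₐ[ℂ] T3 A :=
  Algebra.TensorProduct.map (AlgHom.id ℂ A) flip

/-- `x ⊗ y ⊗ z ↦ y ⊗ x ⊗ z`. -/
def perm213 : T3 A →ₐ[ℂ] T3 A :=
  (Algebra.TensorProduct.leftComm ℂ A A A).toAlgHom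

/-- `x ⊗ y ⊗ z ↦ y ⊗ z ⊗ x`. -/
def perm231 : T3 A →ₐ[ℂ] T3 A :=
  perm132.comp perm213

/-- `x ⊗ y ⊗ z ↦ z ⊗ x ⊗ y`. -/
def perm312 : T3 A →ₐ[ℂ] T3 A :=
  perm213.comp perm132

/-- The linear map `x ⊗ y ↦ f x * c * g y`. -/
def sandwich₂ (f : A →ₗ[ℂ] A) (c : A) (g : A →ₗ[ℂ] A) : A ⊗[ℂ] A →ₗ[ℂ] A :=
  LinearMap.mul' ℂ A ∘ₗ TensorProduct.map f (LinearMap.mulLeft ℂ c ∘ₗ g)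

/-- The linear map `x ⊗ y ⊗ z ↦ f x * c * g y * d * h z`. -/
def sandwich₃ (f : A →ₗ[ℂ] A) (c : A) (g : A →ₗ[ℂ] A) (d : A) (h : A →ₗ[ℂ] A) :
    T3 A →ₗ[ℂ] A :=
  LinearMap.mul' ℂ A ∘ₗ
    TensorProduct.map f (LinearMap.mulLeft ℂ c ∘ₗ sandwich₂ g d h)

/-- On pure tensors the maps above are given by the formulas in their descriptions. -/
theorem maps_tmul (Δ : A →ₐ[ℂ] A ⊗[ℂ] A) (ε : A →ₐ[ℂ] ℂ) (f g h : A →ₗ[ℂ] A)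
    (c d x y z : A) :
    idComul Δ (x ⊗ₜ y) = x ⊗ₜ Δ y ∧
    idCounitId ε (x ⊗ₜ (y ⊗ₜ z)) = x ⊗ₜ (ε y • z) ∧
    tensorOne (x ⊗ₜ (y ⊗ₜ z)) = (x ⊗ₜ (y ⊗ₜ (z ⊗ₜ 1)) : T4 A) ∧
    oneTensor (x ⊗ₜ (y ⊗ₜ z)) = (1 ⊗ₜ (x ⊗ₜ (y ⊗ₜ z)) : T4 A) ∧
    leg12 (x ⊗ₜ y) = (x ⊗ₜ (y ⊗ₜ 1) : T3 A) ∧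
    leg13 (x ⊗ₜ y) = (x ⊗ₜ (1 ⊗ₜ y) : T3 A) ∧
    leg23 (x ⊗ₜ y) = (1 ⊗ₜ (x ⊗ₜ y) : T3 A) ∧
    flip (x ⊗ₜ y) = (y ⊗ₜ x : A ⊗[ℂ] A) ∧
    perm132 (x ⊗ₜ (y ⊗ₜ z)) = (x ⊗ₜ (z ⊗ₜ y) : T3 A) ∧
    perm213 (x ⊗ₜ (y ⊗ₜ z)) = (y ⊗ₜ (x ⊗ₜ z) : T3 A) ∧
    perm231 (x ⊗ₜ (y ⊗ₜ z)) = (y ⊗ₜ (z ⊗ₜ x) : T3 A) ∧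
    perm312 (x ⊗ₜ (y ⊗ₜ z)) = (z ⊗ₜ (x ⊗ₜ y) : T3 A) ∧
    sandwich₂ f c g (x ⊗ₜ y) = f x * c * g y ∧
    sandwich₃ f c g d h (x ⊗ₜ (y ⊗ₜ z)) = f x * c * g y * d * h z := by
  refine ⟨?_, ?_, ?_, ?_, ?_, ?_, ?_, ?_, ?_, ?_, ?_, ?_, ?_, ?_⟩ <;>
    simp [idComul, idCounitId, tensorOne, oneTensor, leg12, leg13, leg23, flip, perm132,
      perm213, perm231, perm312, sandwich₂, sandwich₃, mul_assoc]

variable (A)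

/-- The structure of a quasi-bialgebra on the algebra `A`. -/
structure QuasiBialgebra where
  /-- the comultiplication -/
  comul : A →ₐ[ℂ] A ⊗[ℂ] A
  /-- the counit -/
  counit : A →ₐ[ℂ] ℂ
  /-- the coassociator, an invertible element -/
  coassociator : (T3 A)ˣ
  /-- `(ε ⊗ id) ∘ Δ = id` -/
  counit_comul : ∀ a : A, Algebra.TensorProduct.lid ℂ A
    (Algebra.TensorProduct.map counit (AlgHom.id ℂ A) (comul a)) = a
  /-- `(id ⊗ ε) ∘ Δ = id` -/
  comul_counit : ∀ a : A, Algebra.TensorProduct.rid ℂ ℂ A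
    (Algebra.TensorProduct.map (AlgHom.id ℂ A) counit (comul a)) = a
  /-- quasi-coassociativity, `(Δ ⊗ id)(Δ a) = Φ (id ⊗ Δ)(Δ a) Φ⁻¹` -/
  quasi_coassoc : ∀ a : A, comulId comul (comul a) =
    (coassociator : T3 A) * idComul comul (comul a) * ((coassociator⁻¹ : (T3 A)ˣ) : T3 A)
  /-- `(id ⊗ ε ⊗ id)(Φ) = 1 ⊗ 1` -/
  coassociator_counital : idCounitId counit (coassociator : T3 A) = 1
  /-- the 3-cocycle condition
  `(Δ ⊗ id ⊗ id)(Φ) (id ⊗ id ⊗ Δ)(Φ) = (Φ ⊗ 1) (id ⊗ Δ ⊗ id)(Φ) (1 ⊗ Φ)` -/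
  cocycle : comulIdId comul (coassociator : T3 A) * idIdComul comul (coassociator : T3 A) =
    tensorOne (coassociator : T3 A) * idComulId comul (coassociator : T3 A) *
      oneTensor (coassociator : T3 A)

/-- The structure of a quasi-triangular quasi-bialgebra on the algebra `A`. -/
structure QuasiTriangularQuasiBialgebra extends QuasiBialgebra A where
  /-- the universal R-matrix, an invertible element -/
  rMatrix : (A ⊗[ℂ] A)ˣ
  /-- `R Δ(a) = Δᵒᵖ(a) R` -/
  rMatrix_comul : ∀ a : A,
    (rMatrix : A ⊗[ℂ] A) * comul a = flip (comul a) * (rMatrix : A ⊗[ℂ] A)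
  /-- `(Δ ⊗ id)(R) = Φ₂₃₁⁻¹ R₁₃ Φ₁₃₂ R₂₃ Φ⁻¹` -/
  comulId_rMatrix : comulId comul (rMatrix : A ⊗[ℂ] A) =
    perm231 ((coassociator⁻¹ : (T3 A)ˣ) : T3 A) * leg13 (rMatrix : A ⊗[ℂ] A) *
      perm132 (coassociator : T3 A) * leg23 (rMatrix : A ⊗[ℂ] A) *
      ((coassociator⁻¹ : (T3 A)ˣ) : T3 A)
  /-- `(id ⊗ Δ)(R) = Φ₃₁₂ R₁₃ Φ₂₁₃⁻¹ R₁₂ Φ` -/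
  idComul_rMatrix : idComul comul (rMatrix : A ⊗[ℂ] A) =
    perm312 (coassociator : T3 A) * leg13 (rMatrix : A ⊗[ℂ] A) *
      perm213 ((coassociator⁻¹ : (T3 A)ˣ) : T3 A) * leg12 (rMatrix : A ⊗[ℂ] A) *
      (coassociator : T3 A)

/-- The structure of a quasi-triangular quasi-Hopf algebra on the algebra `A`. -/
structure QuasiTriangularQuasiHopfAlgebra extends QuasiTriangularQuasiBialgebra A where
  /-- the antipode, an anti-homomorphism of algebras -/
  antipode : A →ₗ[ℂ] A
  /-- the evaluation element `α` -/
  evalElt : A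
  /-- the coevaluation element `β` -/
  coevalElt : A
  antipode_one : antipode 1 = 1
  antipode_mul : ∀ a b : A, antipode (a * b) = antipode b * antipode a
  /-- `∑ S(a') α a'' = ε(a) α` -/
  antipode_evalElt : ∀ a : A,
    sandwich₂ antipode evalElt LinearMap.id (comul a) = counit a • evalElt
  /-- `∑ a' β S(a'') = ε(a) β` -/
  coevalElt_antipode : ∀ a : A,
    sandwich₂ LinearMap.id coevalElt antipode (comul a) = counit a • coevalElt
  /-- `∑ S(Φ') α Φ'' β S(Φ''') = 1` -/
  sandwich_coassociator :
    sandwich₃ antipode evalElt LinearMap.id coevalElt antipode (coassociator : T3 A) = 1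
  /-- `∑ (Φ⁻¹)' β S((Φ⁻¹)'') α (Φ⁻¹)''' = 1` -/
  sandwich_coassociator_inv :
    sandwich₃ LinearMap.id coevalElt antipode evalElt LinearMap.id
      ((coassociator⁻¹ : (T3 A)ˣ) : T3 A) = 1

end QuasiHopf

/-! The restricted quantum group of `sl(2)` at `q = i`. -/

namespace RestrictedSL2

/-- Names of the generators `E`, `F`, `K`, `K⁻¹`. -/
inductive Gen : Type
  | E
  | F
  | K
  | Kinv

/-- The defining relations at `q = i` (so `q² = q⁻² = -1` and `q - q⁻¹ = 2i`). -/
inductive Rel : FreeAlgebra ℂ Gen → FreeAlgebra ℂ Gen → Prop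
  | K_mul_Kinv : Rel (FreeAlgebra.ι ℂ Gen.K * FreeAlgebra.ι ℂ Gen.Kinv) 1
  | Kinv_mul_K : Rel (FreeAlgebra.ι ℂ Gen.Kinv * FreeAlgebra.ι ℂ Gen.K) 1
  | K_E : Rel (FreeAlgebra.ι ℂ Gen.K * FreeAlgebra.ι ℂ Gen.E * FreeAlgebra.ι ℂ Gen.Kinv)
      (-FreeAlgebra.ι ℂ Gen.E)
  | K_F : Rel (FreeAlgebra.ι ℂ Gen.K * FreeAlgebra.ι ℂ Gen.F * FreeAlgebra.ι ℂ Gen.Kinv)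
      (-FreeAlgebra.ι ℂ Gen.F)
  | E_F : Rel (FreeAlgebra.ι ℂ Gen.E * FreeAlgebra.ι ℂ Gen.F -
        FreeAlgebra.ι ℂ Gen.F * FreeAlgebra.ι ℂ Gen.E)
      ((2 * Complex.I)⁻¹ • (FreeAlgebra.ι ℂ Gen.K - FreeAlgebra.ι ℂ Gen.Kinv))
  | E_sq : Rel (FreeAlgebra.ι ℂ Gen.E ^ 2) 0
  | F_sq : Rel (FreeAlgebra.ι ℂ Gen.F ^ 2) 0
  | K_pow : Rel (FreeAlgebra.ι ℂ Gen.K ^ 4) 1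

/-- The restricted quantum group of `sl(2)` at `q = i`, as an algebra. -/
def Q : Type := RingQuot Rel

instance : Ring Q := inferInstanceAs (Ring (RingQuot Rel))

instance : Algebra ℂ Q := inferInstanceAs (Algebra ℂ (RingQuot Rel))

/-- The projection of the free algebra onto `Q`. -/
def proj : FreeAlgebra ℂ Gen →ₐ[ℂ] Q := RingQuot.mkAlgHom ℂ Rel

/-- The class in `Q` of a generator. -/
def gen (g : Gen) : Q := proj (FreeAlgebra.ι ℂ g)

theorem proj_rel {x y : FreeAlgebra ℂ Gen} (h : Rel x y) : proj x = proj y :=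
  RingQuot.mkAlgHom_rel ℂ h

/-- The universal property of `Q`: an algebra homomorphism out of `Q` is given by images of the
generators that satisfy the defining relations. -/
def lift {B : Type} [Ring B] [Algebra ℂ B] (f : Gen → B)
    (hf : ∀ ⦃x y : FreeAlgebra ℂ Gen⦄, Rel x y →
      FreeAlgebra.lift ℂ f x = FreeAlgebra.lift ℂ f y) : Q →ₐ[ℂ] B :=
  RingQuot.liftAlgHom ℂ ⟨FreeAlgebra.lift ℂ f, hf⟩

theorem lift_gen {B : Type} [Ring B] [Algebra ℂ B] (f : Gen → B)
    (hf : ∀ ⦃x y : FreeAlgebra ℂ Gen⦄, Rel x y →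
      FreeAlgebra.lift ℂ f x = FreeAlgebra.lift ℂ f y) (g : Gen) : lift f hf (gen g) = f g := by
  have h := RingQuot.liftAlgHom_mkAlgHom_apply ℂ (FreeAlgebra.lift ℂ f) hf (FreeAlgebra.ι ℂ g)
  rw [FreeAlgebra.lift_ι_apply] at h
  exact h

abbrev E : Q := gen Gen.E
abbrev F : Q := gen Gen.F
abbrev K : Q := gen Gen.K
abbrev Kinv : Q := gen Gen.Kinv

theorem K_mul_Kinv : K * Kinv = 1 := by
  simpa [gen] using proj_rel Rel.K_mul_Kinv

theorem Kinv_mul_K : Kinv * K = 1 := by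
  simpa [gen] using proj_rel Rel.Kinv_mul_K

theorem K_mul_E : K * E = -(E * K) := by
  have h : K * E * Kinv = -E := by
    simpa [gen] using proj_rel Rel.K_E
  calc K * E = K * E * (Kinv * K) := by rw [Kinv_mul_K, mul_one]
    _ = K * E * Kinv * K := by rw [mul_assoc, mul_assoc, mul_assoc]
    _ = -(E * K) := by rw [h, neg_mul]

theorem K_mul_F : K * F = -(F * K) := by
  have h : K * F * Kinv = -F := by
    simpa [gen] using proj_rel Rel.K_F
  calc K * F = K * F * (Kinv * K) := by rw [Kinv_mul_K, mul_one]
    _ = K * F * Kinv * K := by rw [mul_assoc, mul_assoc, mul_assoc]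
    _ = -(F * K) := by rw [h, neg_mul]

theorem E_mul_F : E * F - F * E = (2 * Complex.I)⁻¹ • (K - Kinv) := by
  simpa only [gen, map_sub, map_mul, map_smul] using proj_rel Rel.E_F

theorem E_sq : E * E = 0 := by
  simpa [gen, pow_two] using proj_rel Rel.E_sq

theorem F_sq : F * F = 0 := by
  simpa [gen, pow_two] using proj_rel Rel.F_sq

theorem K_pow : K ^ 4 = 1 := by
  simpa [gen] using proj_rel Rel.K_pow

theorem Kinv_mul_E : Kinv * E = -(E * Kinv) := by
  calc Kinv * E = Kinv * E * (K * Kinv) := by rw [K_mul_Kinv, mul_one]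
    _ = Kinv * (E * K) * Kinv := by simp only [mul_assoc]
    _ = -((Kinv * K) * E * Kinv) := by
      rw [← neg_neg (E * K), ← K_mul_E]; simp only [mul_assoc, mul_neg, neg_mul]
    _ = -(E * Kinv) := by rw [Kinv_mul_K, one_mul]

theorem Kinv_mul_F : Kinv * F = -(F * Kinv) := by
  calc Kinv * F = Kinv * F * (K * Kinv) := by rw [K_mul_Kinv, mul_one]
    _ = Kinv * (F * K) * Kinv := by simp only [mul_assoc]
    _ = -((Kinv * K) * F * Kinv) := by
      rw [← neg_neg (F * K), ← K_mul_F]; simp only [mul_assoc, mul_neg, neg_mul]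
    _ = -(F * Kinv) := by rw [Kinv_mul_K, one_mul]

theorem Kinv_pow : Kinv ^ 4 = 1 := by
  have h : Commute Kinv K := by rw [Commute, SemiconjBy, Kinv_mul_K, K_mul_Kinv]
  have h2 : (Kinv * K) ^ 4 = 1 := by rw [Kinv_mul_K, one_pow]
  rwa [h.mul_pow, K_pow, mul_one] at h2

/-- Two algebra homomorphisms out of `Q` that agree on the generators are equal. -/
theorem algHom_ext {B : Type*} [Semiring B] [Algebra ℂ B] {f g : Q →ₐ[ℂ] B}
    (h : ∀ x, f (gen x) = g (gen x)) : f = g := by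
  apply RingQuot.ringQuot_ext'
  apply FreeAlgebra.hom_ext
  funext x
  exact h x

/-- Values of the comultiplication on generators. -/
def comulGen : Gen → Q ⊗[ℂ] Q
  | Gen.E => 1 ⊗ₜ E + E ⊗ₜ K
  | Gen.F => Kinv ⊗ₜ F + F ⊗ₜ 1
  | Gen.K => K ⊗ₜ K
  | Gen.Kinv => Kinv ⊗ₜ Kinv

/-- Values of the counit on generators. -/
def counitGen : Gen → ℂ
  | Gen.E => 0
  | Gen.F => 0
  | Gen.K => 1
  | Gen.Kinv => 1

/-- Values of the antipode on generators, in the opposite algebra. -/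
def antipodeGen : Gen → Qᵐᵒᵖ
  | Gen.E => MulOpposite.op (-(E * Kinv))
  | Gen.F => MulOpposite.op (-(K * F))
  | Gen.K => MulOpposite.op Kinv
  | Gen.Kinv => MulOpposite.op K

theorem F_mul_E : F * E = E * F - (2 * Complex.I)⁻¹ • (K - Kinv) := by
  rw [← E_mul_F]; abel

/-- The relations as left-to-right rewriting rules inside longer products. -/
theorem normalize (x : Q) :
    K * (Kinv * x) = x ∧ Kinv * (K * x) = x ∧ K * (E * x) = -(E * (K * x)) ∧
    K * (F * x) = -(F * (K * x)) ∧ Kinv * (E * x) = -(E * (Kinv * x)) ∧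
    Kinv * (F * x) = -(F * (Kinv * x)) ∧ E * (E * x) = 0 ∧ F * (F * x) = 0 ∧
    F * (E * x) = E * (F * x) - (2 * Complex.I)⁻¹ • (K * x - Kinv * x) := by
  refine ⟨?_, ?_, ?_, ?_, ?_, ?_, ?_, ?_, ?_⟩
  · rw [← mul_assoc, K_mul_Kinv, one_mul]
  · rw [← mul_assoc, Kinv_mul_K, one_mul]
  · rw [← mul_assoc, K_mul_E, neg_mul, mul_assoc]
  · rw [← mul_assoc, K_mul_F, neg_mul, mul_assoc]
  · rw [← mul_assoc, Kinv_mul_E, neg_mul, mul_assoc]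
  · rw [← mul_assoc, Kinv_mul_F, neg_mul, mul_assoc]
  · rw [← mul_assoc, E_sq, zero_mul]
  · rw [← mul_assoc, F_sq, zero_mul]
  · rw [← mul_assoc, F_mul_E, sub_mul, smul_mul_assoc, sub_mul, mul_assoc]

theorem comulGen_rel ⦃x y : FreeAlgebra ℂ Gen⦄ (h : Rel x y) :
    FreeAlgebra.lift ℂ comulGen x = FreeAlgebra.lift ℂ comulGen y := by
  cases h <;> simp only [map_mul, map_sub, map_neg, map_smul, map_pow, map_one, map_zero,
    FreeAlgebra.lift_ι_apply, comulGen, pow_two, mul_add, add_mul,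
    Algebra.TensorProduct.tmul_mul_tmul, Algebra.TensorProduct.tmul_pow, K_pow, mul_one, one_mul,
    mul_assoc, K_mul_Kinv, Kinv_mul_K, K_mul_E, K_mul_F, Kinv_mul_E, E_sq, F_sq, F_mul_E,
    Kinv_mul_F, normalize, TensorProduct.tmul_neg, TensorProduct.neg_tmul,
    TensorProduct.tmul_zero, TensorProduct.zero_tmul, Algebra.TensorProduct.one_def]
  · abel
  · abel
  · simp only [TensorProduct.tmul_sub, TensorProduct.sub_tmul, TensorProduct.tmul_smul,
      ← TensorProduct.smul_tmul', smul_sub]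
    abel
  · abel
  · abel

theorem counitGen_rel ⦃x y : FreeAlgebra ℂ Gen⦄ (h : Rel x y) :
    FreeAlgebra.lift ℂ counitGen x = FreeAlgebra.lift ℂ counitGen y := by
  cases h <;> simp [counitGen]

theorem antipodeGen_rel ⦃x y : FreeAlgebra ℂ Gen⦄ (h : Rel x y) :
    FreeAlgebra.lift ℂ antipodeGen x = FreeAlgebra.lift ℂ antipodeGen y := by
  cases h <;> simp only [map_mul, map_sub, map_neg, map_smul, map_pow, map_one, map_zero,
    FreeAlgebra.lift_ι_apply, antipodeGen, pow_two, ← MulOpposite.op_mul, ← MulOpposite.op_sub,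
    ← MulOpposite.op_neg, ← MulOpposite.op_smul, ← MulOpposite.op_one, ← MulOpposite.op_zero,
    ← MulOpposite.op_pow] <;> congr 1
  · exact K_mul_Kinv
  · exact Kinv_mul_K
  · simp [mul_assoc, normalize]
  · simp [mul_assoc, K_mul_Kinv, normalize]
  · simp only [neg_mul, mul_assoc, normalize, mul_neg, K_mul_Kinv, neg_neg, mul_one,
      mul_sub, mul_smul_comm, smul_sub]
    abel
  · simp [mul_assoc, normalize]
  · simp [mul_assoc, normalize, K_mul_F]
  · exact Kinv_pow

/-- The comultiplication of `Q`. -/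
def comulHom : Q →ₐ[ℂ] Q ⊗[ℂ] Q := lift comulGen comulGen_rel

/-- The counit of `Q`. -/
def counitHom : Q →ₐ[ℂ] ℂ := lift counitGen counitGen_rel

/-- The antipode of `Q`, as an algebra homomorphism to the opposite algebra. -/
def antipodeOp : Q →ₐ[ℂ] Qᵐᵒᵖ := lift antipodeGen antipodeGen_rel

/-- The antipode of `Q`. -/
def antipodeMap : Q →ₗ[ℂ] Q :=
  (MulOpposite.opLinearEquiv ℂ).symm.toLinearMap ∘ₗ antipodeOp.toLinearMap

theorem antipodeMap_one : antipodeMap 1 = 1 := by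
  simp [antipodeMap]

theorem antipodeMap_mul (a b : Q) : antipodeMap (a * b) = antipodeMap b * antipodeMap a := by
  simp [antipodeMap]

theorem comulHom_gen (g : Gen) : comulHom (gen g) = comulGen g := lift_gen _ _ g

theorem counitHom_gen (g : Gen) : counitHom (gen g) = counitGen g := lift_gen _ _ g

theorem antipodeMap_gen (g : Gen) : antipodeMap (gen g) = (antipodeGen g).unop :=
  congrArg MulOpposite.unop (lift_gen antipodeGen antipodeGen_rel g)

instance : Bialgebra ℂ Q :=
  Bialgebra.ofAlgHom comulHom counitHom
    (by
      apply algHom_ext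
      intro x
      cases x <;> simp [comulHom_gen, comulGen, TensorProduct.tmul_add, TensorProduct.add_tmul,
        Algebra.TensorProduct.one_def, add_assoc])
    (by
      apply algHom_ext
      intro x
      cases x <;> simp [comulHom_gen, comulGen, counitHom_gen, counitGen])
    (by
      apply algHom_ext
      intro x
      cases x <;> simp [comulHom_gen, comulGen, counitHom_gen, counitGen])

/-- An induction principle: a property closed under sums and products that holds for scalars and
generators holds on all of `Q`. -/
theorem induction {p : Q → Prop} (h1 : ∀ c : ℂ, p (algebraMap ℂ Q c)) (hg : ∀ g, p (gen g))
    (hm : ∀ a b, p a → p b → p (a * b)) (ha : ∀ a b, p a → p b → p (a + b)) (x : Q) : p x := by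
  obtain ⟨y, rfl⟩ : ∃ y, proj y = x := RingQuot.mkAlgHom_surjective ℂ Rel x
  induction y using FreeAlgebra.induction with
  | grade0 r => rw [AlgHom.commutes]; exact h1 r
  | grade1 g => exact hg g
  | mul a b h h' => rw [map_mul]; exact hm _ _ h h'
  | add a b h h' => rw [map_add]; exact ha _ _ h h'

theorem mul_antipode_left (s t : Q ⊗[ℂ] Q) (c : ℂ)
    (hs : LinearMap.mul' ℂ Q (antipodeMap.rTensor Q s) = algebraMap ℂ Q c) :
    LinearMap.mul' ℂ Q (antipodeMap.rTensor Q (s * t)) =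
      algebraMap ℂ Q c * LinearMap.mul' ℂ Q (antipodeMap.rTensor Q t) := by
  induction t using TensorProduct.induction_on with
  | zero => simp
  | add a b h h' => simp only [mul_add, map_add, h, h']
  | tmul x y =>
    have key : ∀ r : Q ⊗[ℂ] Q, LinearMap.mul' ℂ Q (antipodeMap.rTensor Q (r * x ⊗ₜ y)) =
        antipodeMap x * LinearMap.mul' ℂ Q (antipodeMap.rTensor Q r) * y := by
      intro r
      induction r using TensorProduct.induction_on with
      | zero => simp
      | add a b h h' => simp only [mul_add, add_mul, map_add, h, h']
      | tmul u v => simp [antipodeMap_mul, mul_assoc]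
    rw [key, hs, ← Algebra.commutes, mul_assoc]
    simp

theorem mul_antipode_right (s t : Q ⊗[ℂ] Q) (c : ℂ)
    (ht : LinearMap.mul' ℂ Q (antipodeMap.lTensor Q t) = algebraMap ℂ Q c) :
    LinearMap.mul' ℂ Q (antipodeMap.lTensor Q (s * t)) =
      LinearMap.mul' ℂ Q (antipodeMap.lTensor Q s) * algebraMap ℂ Q c := by
  induction s using TensorProduct.induction_on with
  | zero => simp
  | add a b h h' => simp only [add_mul, map_add, h, h']
  | tmul x y =>
    have key : ∀ r : Q ⊗[ℂ] Q, LinearMap.mul' ℂ Q (antipodeMap.lTensor Q (x ⊗ₜ y * r)) =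
        x * LinearMap.mul' ℂ Q (antipodeMap.lTensor Q r) * antipodeMap y := by
      intro r
      induction r using TensorProduct.induction_on with
      | zero => simp
      | add a b h h' => simp only [mul_add, add_mul, map_add, h, h']
      | tmul u v => simp [antipodeMap_mul, mul_assoc]
    rw [key, ht, mul_assoc, Algebra.commutes, ← mul_assoc]
    simp

theorem antipode_comul_left (x : Q) :
    LinearMap.mul' ℂ Q (antipodeMap.rTensor Q (comulHom x)) = algebraMap ℂ Q (counitHom x) := by
  induction x using induction with
  | h1 c => simp [Algebra.algebraMap_eq_smul_one, Algebra.TensorProduct.one_def, antipodeMap_one]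
  | hg g =>
    cases g <;> simp [comulHom_gen, comulGen, counitHom_gen, counitGen, antipodeMap_gen,
      antipodeGen, antipodeMap_one, mul_assoc, K_mul_Kinv, Kinv_mul_K]
  | ha a b h h' => simp only [map_add, h, h']
  | hm a b h h' =>
    rw [map_mul, mul_antipode_left _ _ _ h, h', map_mul, map_mul]

theorem antipode_comul_right (x : Q) :
    LinearMap.mul' ℂ Q (antipodeMap.lTensor Q (comulHom x)) = algebraMap ℂ Q (counitHom x) := by
  induction x using induction with
  | h1 c => simp [Algebra.algebraMap_eq_smul_one, Algebra.TensorProduct.one_def, antipodeMap_one]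
  | hg g =>
    cases g <;> simp [comulHom_gen, comulGen, counitHom_gen, counitGen, antipodeMap_gen,
      antipodeGen, antipodeMap_one, K_mul_Kinv, Kinv_mul_K, normalize]
  | ha a b h h' => simp only [map_add, h, h']
  | hm a b h h' =>
    rw [map_mul, mul_antipode_right _ _ _ h', h, map_mul, map_mul]

/-- The Hopf algebra structure of `Q`. -/
instance : HopfAlgebra ℂ Q where
  antipode := antipodeMap
  mul_antipode_rTensor_comul := LinearMap.ext antipode_comul_left
  mul_antipode_lTensor_comul := LinearMap.ext antipode_comul_right

theorem comulAlgHom_gen (g : Gen) : Bialgebra.comulAlgHom ℂ Q (gen g) = comulGen g :=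
  comulHom_gen g

theorem counitAlgHom_gen (g : Gen) : Bialgebra.counitAlgHom ℂ Q (gen g) = counitGen g :=
  counitHom_gen g

theorem antipode_gen (g : Gen) :
    HopfAlgebra.antipode ℂ (gen g) = (antipodeGen g).unop :=
  antipodeMap_gen g

open Complex (I)
open QuasiHopf (T3)

/-- The central idempotent `e₀ = (1 + K²) / 2`. -/
def e0 : Q := (1 / 2 : ℂ) • (1 + K ^ 2)

/-- The central idempotent `e₁ = (1 - K²) / 2`. -/
def e1 : Q := (1 / 2 : ℂ) • (1 - K ^ 2)

/-- The component `Φ⁰¹⁰` of the coassociator. -/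
def Phi010 : T3 Q :=
  1 ⊗ₜ (1 ⊗ₜ 1)
  - (1 + I) • E ⊗ₜ (K ⊗ₜ F)
  + (1 - I) • (F * K) ⊗ₜ (K ⊗ₜ (E * K))
  + (2 : ℂ) • (E * F * K) ⊗ₜ (1 ⊗ₜ (E * F * K))

/-- The component `Φ¹⁰¹` of the coassociator. -/
def Phi101 : T3 Q :=
  (I - 1) • 1 ⊗ₜ (F ⊗ₜ (E * K))
  + 1 ⊗ₜ (K ⊗ₜ 1)
  + (2 : ℂ) • 1 ⊗ₜ ((E * F) ⊗ₜ (E * F * K))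
  - (1 + I) • 1 ⊗ₜ ((E * K) ⊗ₜ F)
  - (1 + I) • E ⊗ₜ ((F * K) ⊗ₜ 1)
  + (2 * I) • E ⊗ₜ ((E * F * K) ⊗ₜ F)
  + (1 - I) • (F * K) ⊗ₜ (E ⊗ₜ 1)
  - (2 * I) • (F * K) ⊗ₜ ((E * F * K) ⊗ₜ (E * K))
  - (2 : ℂ) • (E * F * K) ⊗ₜ ((E * F) ⊗ₜ 1)

/-- The component `Φ¹¹¹` of the coassociator. -/
def Phi111 (β : ℂ) : T3 Q :=
  (I * β ^ 2) •
    ((1 + I) • 1 ⊗ₜ (F ⊗ₜ (E * K))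
    - 1 ⊗ₜ (K ⊗ₜ 1)
    - (2 : ℂ) • 1 ⊗ₜ ((E * F) ⊗ₜ 1)
    - (2 * I) • 1 ⊗ₜ ((E * F) ⊗ₜ (E * F * K))
    + (1 + I) • 1 ⊗ₜ ((E * K) ⊗ₜ F)
    - (1 + I) • E ⊗ₜ (1 ⊗ₜ F)
    + (1 + I) • E ⊗ₜ ((F * K) ⊗ₜ 1)
    + (2 * I) • E ⊗ₜ ((F * K) ⊗ₜ (E * F * K))
    + (2 : ℂ) • E ⊗ₜ ((E * F * K) ⊗ₜ F)
    - (1 + I) • (F * K) ⊗ₜ (1 ⊗ₜ (E * K))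
    + (1 + I) • (F * K) ⊗ₜ (E ⊗ₜ 1)
    + (2 * I) • (F * K) ⊗ₜ (E ⊗ₜ (E * F * K))
    + (2 : ℂ) • (F * K) ⊗ₜ ((E * F * K) ⊗ₜ (E * K))
    + (2 * I) • (E * F * K) ⊗ₜ (F ⊗ₜ (E * K))
    + (2 * I) • (E * F * K) ⊗ₜ (K ⊗ₜ (E * F * K))
    - (2 * I) • (E * F * K) ⊗ₜ ((E * F) ⊗ₜ 1)
    + (2 * I) • (E * F * K) ⊗ₜ ((E * K) ⊗ₜ F)
    + (4 : ℂ) • (E * F * K) ⊗ₜ ((E * F) ⊗ₜ (E * F * K)))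

/-- The coassociator `Φ`. -/
def Phi (β : ℂ) : T3 Q :=
  e0 ⊗ₜ (e0 ⊗ₜ e0)
  + e1 ⊗ₜ (e0 ⊗ₜ e0)
  + Phi010 * e0 ⊗ₜ (e1 ⊗ₜ e0)
  + e0 ⊗ₜ (e0 ⊗ₜ e1)
  + e1 ⊗ₜ (e1 ⊗ₜ e0)
  + Phi101 * e1 ⊗ₜ (e0 ⊗ₜ e1)
  + e0 ⊗ₜ (e1 ⊗ₜ e1)
  + Phi111 β * e1 ⊗ₜ (e1 ⊗ₜ e1)

/-- The component `R⁰⁰` of the R-matrix. -/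
def R00 : Q ⊗[ℂ] Q :=
  (1 / 2 : ℂ) • (1 ⊗ₜ 1 + 1 ⊗ₜ K + K ⊗ₜ 1 - K ⊗ₜ K) *
    (1 ⊗ₜ 1 + (2 * I) • E ⊗ₜ F)

/-- The component `R⁰¹` of the R-matrix. -/
def R01 : Q ⊗[ℂ] Q :=
  (1 / 2 : ℂ) • (1 ⊗ₜ 1 - I • 1 ⊗ₜ K + K ⊗ₜ 1 + I • K ⊗ₜ K) *
    (1 ⊗ₜ 1
      + (1 - I) • (F * K) ⊗ₜ (E * K)
      - (1 - I) • E ⊗ₜ F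
      + (1 + I) • (E * F * K) ⊗ₜ 1
      + (2 * I) • (E * F * K) ⊗ₜ (E * F * K))

/-- The component `R¹⁰` of the R-matrix. -/
def R10 : Q ⊗[ℂ] Q :=
  (1 / 2 : ℂ) • (1 ⊗ₜ 1 + 1 ⊗ₜ K - I • K ⊗ₜ 1 + I • K ⊗ₜ K) *
    (1 ⊗ₜ K
      + (1 - I) • (F * K) ⊗ₜ E
      + (1 - I) • E ⊗ₜ (F * K)
      - (1 - I) • 1 ⊗ₜ (E * F)
      - (2 * I) • (E * F * K) ⊗ₜ (E * F))

/-- The component `R¹¹` of the R-matrix. -/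
def R11 (β : ℂ) : Q ⊗[ℂ] Q :=
  (β / 2) • (1 ⊗ₜ 1 - I • 1 ⊗ₜ K - I • K ⊗ₜ 1 + K ⊗ₜ K) *
    (-(I • K ⊗ₜ 1)
      + (2 * I) • (E * K) ⊗ₜ F
      + (1 - I) • K ⊗ₜ (E * F * K)
      - (1 + I) • (E * F) ⊗ₜ 1
      - (2 * I) • (E * F) ⊗ₜ (E * F * K))

/-- The R-matrix `R`. -/
def RMat (β : ℂ) : Q ⊗[ℂ] Q :=
  R00 * e0 ⊗ₜ e0 + R01 * e0 ⊗ₜ e1 + R10 * e1 ⊗ₜ e0 + R11 β * e1 ⊗ₜ e1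

/-- The standard R-matrix
`(1/2) ∑ (-1)^(mn) K^m ⊗ K^n (1 ⊗ 1 + 2i E ⊗ F)`, with `m, n` running over `0, 1`. -/
def RStandard : Q ⊗[ℂ] Q :=
  (1 / 2 : ℂ) • ∑ m ∈ Finset.range 2, ∑ n ∈ Finset.range 2,
    ((-1 : ℂ) ^ (m * n)) • (K ^ m) ⊗ₜ (K ^ n) * (1 ⊗ₜ 1 + (2 * I) • E ⊗ₜ F)

/-- The Casimir element `C = F E - (i/4) (K - K⁻¹)`. -/
def Casimir : Q := F * E - (I / 4) • (K - Kinv)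

end RestrictedSL2

end

/-! ### Sparse coordinates in tensor powers -/

/-! The theorem is a finite computation once `Q` has a good basis. Put G = -iFK. Then E² = G² = 0,
EG + GE = e₁, K anticommutes with E and G, K² = e₀ - e₁, and e₀, e₁ are orthogonal central
idempotents with sum 1. So a product of two of the sixteen elements G^g E^e K^k eₛ is a sum of at
most two of them with signs, and no other scalars enter the multiplication table
(`isTable_basisElt`). E and G are moreover skew-primitive of the same kind, which keeps the
coproduct simple.

The scalars in Φ, R and the coevaluation element lie in ℤ[1/2, β]: from β⁴ = -1 it follows that i =
±β², and a Boolean σ records the sign (`exists_iCoef`). An element of a tensor power of `Q` is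
represented by nested lists of labels ending in such scalars. `isModel_listEval` shows, one tensor
factor at a time, that list arithmetic computes in the algebra; the structure maps are transported
in the same way. Only one direction is needed: zero coordinates represent the zero element. Hence
linear independence of the sixteen elements plays no role.

Axioms for all a ∈ `Q` that compare algebra homomorphisms reduce to the generators
(`mul_eq_mul_of_gen`). The two antipode axioms follow from those of the Hopf algebra, because α = 1
and the coevaluation element is central (`coevalElt_central`). What remains is a list of identities
between explicit elements, including invertibility of Φ and R with inverses written as polynomials.
`isQuasiHopfCode` evaluates them for both signs, and `IsQuasiHopfCode.exists_quasiHopf` carries the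
results back to `Q`. -/

namespace SparseCode

/-- The numbers `(a + c β²) / 2 ^ n` and `(a + b β + c β² + d β³) / 2 ^ n`, where `β⁴ = -1`. -/
inductive Coef where
  | even (n : ℕ) (a c : ℤ)
  | full (n : ℕ) (a b c d : ℤ)

/-- The labels of the basis `G ^ g * E ^ e * K ^ k * eₛ` of the quantum group; the exponents are
the binary digits of `8 s + 4 g + 2 e + k`. -/
abbrev Mono : Type := ℕ

/-- The product of a sign (`true` for `-1`) and an element. -/
def signed {A : Type*} [Neg A] (b : Bool) (x : A) : A := bif b then -x else x

/-- Data on which the operations of an algebra can be computed; `mulAdd s x y z` stands for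
`z + x * y` or `z - x * y`. -/
class Code (X : Type) where
  zero : X
  one : X
  add : X → X → X
  neg : X → X
  mulAdd : Bool → X → X → X → X
  smul : Coef → X → X
  isZero : X → Bool

instance {X : Type} [Code X] : Zero X := ⟨Code.zero⟩
instance {X : Type} [Code X] : One X := ⟨Code.one⟩
instance {X : Type} [Code X] : Add X := ⟨Code.add⟩
instance {X : Type} [Code X] : Neg X := ⟨Code.neg⟩
instance {X : Type} [Code X] : Mul X := ⟨fun x y => Code.mulAdd false x y 0⟩
instance {X : Type} [Code X] : SMul Coef X := ⟨Code.smul⟩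
instance {X : Type} [Code X] : Sub X := ⟨fun x y => x + -y⟩

/-- Codes with operations that compute those of the algebra `A`. -/
structure IsModel {X : Type} [Code X] {A : Type} [Ring A] [Algebra ℂ A]
    (c : Coef → ℂ) (ev : X → A) : Prop where
  zero : ev 0 = 0
  one : ev 1 = 1
  add : ∀ x y, ev (x + y) = ev x + ev y
  neg : ∀ x, ev (-x) = -ev x
  mulAdd : ∀ s x y z, ev (Code.mulAdd s x y z) = ev z + signed s (ev x * ev y)
  smul : ∀ r x, ev (r • x) = c r • ev x
  -- An implication suffices: `ev` need not be injective, and a code may have several forms.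
  isZero : ∀ x, Code.isZero x = true → ev x = 0

section
variable {X : Type} [Code X] {A : Type} [Ring A] [Algebra ℂ A] {c : Coef → ℂ} {ev : X → A}

theorem IsModel.mul (h : IsModel c ev) (x y : X) : ev (x * y) = ev x * ev y :=
  (h.mulAdd false x y 0).trans (by rw [h.zero, zero_add]; rfl)

theorem IsModel.sub (h : IsModel c ev) (x y : X) : ev (x - y) = ev x - ev y := by
  rw [sub_eq_add_neg (ev x), ← h.neg, ← h.add]
  rfl

/-- The transfer principle: every identity decided on codes enters the algebra through this lemma.
-/
theorem IsModel.ext (h : IsModel c ev) {x y : X} (hxy : Code.isZero (x - y) = true) :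
    ev x = ev y :=
  sub_eq_zero.1 ((h.sub x y).symm.trans (h.isZero _ hxy))

end

/-! ### Arithmetic in ℤ[1/2, β] with β⁴ = -1 -/

namespace Coef

/-- The arithmetic below uses the bare functions on ℤ and ℕ, so that evaluation passes through no
type class instances; these equations return to the usual notation. Denominators are never
cancelled, since a zero test sees only the numerators. -/
theorem int_sub (a b : ℤ) : a.sub b = a - b := rfl

theorem int_neg (a : ℤ) : a.neg = -a := rfl

/-- The value of a coefficient. -/
noncomputable def eval (β : ℂ) : Coef → ℂ
  | even n a c => (a + c * β ^ 2) * (1 / 2) ^ n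
  | full n a b c d => (a + b * β + c * β ^ 2 + d * β ^ 3) * (1 / 2) ^ n

/-- The same number in the general form. -/
def toFull : Coef → Coef
  | even n a c => full n a 0 c 0
  | full n a b c d => full n a b c d

/-- The exponent of the denominator. -/
def exponent : Coef → ℕ
  | even n _ _ => n
  | full n _ _ _ _ => n

/-- The same number with a larger denominator. -/
def shift (m : ℕ) : Coef → Coef
  | even n a c => even (n.add m) (a.mul (2 ^ m)) (c.mul (2 ^ m))
  | full n a b c d =>
    full (n.add m) (a.mul (2 ^ m)) (b.mul (2 ^ m)) (c.mul (2 ^ m)) (d.mul (2 ^ m))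

/-- The sum of coefficients with the same denominator. -/
def addSame : Coef → Coef → Coef
  | even n a c, even _ a' c' => even n (a.add a') (c.add c')
  | even n a c, full _ a' b' c' d' => full n (a.add a') b' (c.add c') d'
  | full n a b c d, even _ a' c' => full n (a.add a') b (c.add c') d
  | full n a b c d, full _ a' b' c' d' => full n (a.add a') (b.add b') (c.add c') (d.add d')

def add (x y : Coef) : Coef :=
  bif Nat.beq x.exponent y.exponent then addSame x y
  else bif Nat.ble x.exponent y.exponent then
    addSame (x.shift (y.exponent.sub x.exponent)) y
  else addSame x (y.shift (x.exponent.sub y.exponent))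

def neg : Coef → Coef
  | even n a c => even n a.neg c.neg
  | full n a b c d => full n a.neg b.neg c.neg d.neg

def mul : Coef → Coef → Coef
  | even n a c, even m a' c' =>
    even (n.add m) ((a.mul a').sub (c.mul c')) ((a.mul c').add (c.mul a'))
  | even n a c, full m a' b' c' d' =>
    full (n.add m) ((a.mul a').sub (c.mul c')) ((a.mul b').sub (c.mul d'))
      ((a.mul c').add (c.mul a')) ((a.mul d').add (c.mul b'))
  | full n a b c d, even m a' c' =>
    full (n.add m) ((a.mul a').sub (c.mul c')) ((b.mul a').sub (d.mul c'))
      ((a.mul c').add (c.mul a')) ((b.mul c').add (d.mul a'))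
  | full n a b c d, full m a' b' c' d' =>
    full (n.add m)
      ((((a.mul a').sub (b.mul d')).sub (c.mul c')).sub (d.mul b'))
      ((((a.mul b').add (b.mul a')).sub (c.mul d')).sub (d.mul c'))
      ((((a.mul c').add (b.mul b')).add (c.mul a')).sub (d.mul d'))
      ((((a.mul d').add (b.mul c')).add (c.mul b')).add (d.mul a'))

def isZero : Coef → Bool
  | even _ a c => decide (a = 0) && decide (c = 0)
  | full _ a b c d => decide (a = 0) && decide (b = 0) && decide (c = 0) && decide (d = 0)

instance : Code Coef where
  zero := even 0 0 0
  one := even 0 1 0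
  add := add
  neg := neg
  mulAdd s x y z := add z (bif s then neg (mul x y) else mul x y)
  smul := mul
  isZero := isZero

theorem eval_shift (β : ℂ) (m : ℕ) (x : Coef) : (x.shift m).eval β = x.eval β := by
  have h : (2 : ℂ) ^ m * (1 / 2) ^ m = 1 := by rw [← mul_pow]; norm_num
  cases x <;> simp only [eval, shift, Int.mul_def, Nat.add_eq, pow_add] <;> push_cast
  case even n a c => linear_combination (a + c * β ^ 2) * (1 / 2) ^ n * h
  case full n a b c d =>
    linear_combination (a + b * β + c * β ^ 2 + d * β ^ 3) * (1 / 2) ^ n * h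

theorem exponent_shift (m : ℕ) (x : Coef) : (x.shift m).exponent = x.exponent + m := by
  cases x <;> rfl

theorem eval_addSame (β : ℂ) (x y : Coef) (h : x.exponent = y.exponent) :
    (addSame x y).eval β = x.eval β + y.eval β := by
  cases x <;> cases y <;> simp only [exponent] at h <;>
    simp only [eval, addSame, h, Int.add_def] <;> push_cast <;> ring

theorem eval_add (β : ℂ) (x y : Coef) : (add x y).eval β = x.eval β + y.eval β := by
  unfold add
  cases h1 : Nat.beq x.exponent y.exponent
  · cases h2 : Nat.ble x.exponent y.exponent
    · have h : ¬ x.exponent ≤ y.exponent := fun h => by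
        rw [Nat.ble_eq_true_of_le h] at h2; simp at h2
      rw [cond_false, cond_false, eval_addSame, eval_shift]
      rw [exponent_shift, Nat.sub_eq]
      omega
    · have h := Nat.le_of_ble_eq_true h2
      rw [cond_false, cond_true, eval_addSame, eval_shift]
      rw [exponent_shift, Nat.sub_eq]
      omega
  · exact eval_addSame β x y (Nat.eq_of_beq_eq_true h1)

theorem eval_neg (β : ℂ) (x : Coef) : (neg x).eval β = -x.eval β := by
  cases x <;> simp only [eval, neg, int_neg] <;> push_cast <;> ring

theorem eval_toFull (β : ℂ) (x : Coef) : x.toFull.eval β = x.eval β := by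
  cases x <;> simp [eval, toFull]

/-- The shape without odd powers of β is only a shortcut; this reduces the four cases of a product
to the general one. -/
theorem toFull_mul (x y : Coef) : (mul x y).toFull = mul x.toFull y.toFull := by
  cases x <;> cases y <;> simp [mul, toFull, Int.mul_def, Int.add_def, int_sub]

theorem eval_mul {β : ℂ} (hβ : β ^ 4 = -1) (x y : Coef) :
    (mul x y).eval β = x.eval β * y.eval β := by
  have key : ∀ (n m : ℕ) (a b c d a' b' c' d' : ℤ),
      (mul (full n a b c d) (full m a' b' c' d')).eval β =
        (full n a b c d).eval β * (full m a' b' c' d').eval β := by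
    intro n m a b c d a' b' c' d'
    simp only [eval, mul, Nat.add_eq, pow_add, Int.mul_def, Int.add_def, int_sub]
    push_cast
    -- The factor collects the terms of degree 4, 5 and 6 in β of the product, divided by β⁴.
    linear_combination (-(1 / 2) ^ n * (1 / 2) ^ m *
      ((b * d' + c * c' + d * b' : ℂ) + (c * d' + d * c') * β + d * d' * β ^ 2)) * hβ
  rw [← eval_toFull, toFull_mul, ← eval_toFull β x, ← eval_toFull β y]
  cases x <;> cases y <;> exact key _ _ _ _ _ _ _ _ _ _

theorem isModel {β : ℂ} (hβ : β ^ 4 = -1) : IsModel (eval β) (eval β) where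
  zero := by change eval β (even 0 0 0) = 0; simp [eval]
  one := by change eval β (even 0 1 0) = 1; simp [eval]
  add := eval_add β
  neg := eval_neg β
  mulAdd s x y z := by
    cases s
    · exact (eval_add β _ _).trans (congrArg _ (eval_mul hβ x y))
    · exact (eval_add β _ _).trans (congrArg _ ((eval_neg β _).trans
        (congrArg _ (eval_mul hβ x y))))
  smul := eval_mul hβ
  isZero x h := by
    change isZero x = true at h
    cases x <;> simp only [isZero, Bool.and_eq_true, decide_eq_true_eq] at h <;> simp [eval, h]

end Coef

/-! ### The multiplication table -/

namespace Mono

/-- The label with given exponents. -/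
def ofBits (s g e k : Bool) : Mono :=
  (bif s then 8 else 0) + (bif g then 4 else 0) + (bif e then 2 else 0) + (bif k then 1 else 0)

/-- A binary digit of a label. -/
def digit (i : ℕ) (x : Mono) : Bool := Nat.beq (Nat.land (Nat.shiftRight x i) 1) 1

/-- The index of the central idempotent. -/
def s (x : Mono) : Bool := digit 3 x
/-- The exponent of `G`. -/
def g (x : Mono) : Bool := digit 2 x
/-- The exponent of `E`. -/
def e (x : Mono) : Bool := digit 1 x
/-- The exponent of `K`. -/
def k (x : Mono) : Bool := digit 0 x

theorem digits_ofBits (s g e k : Bool) : (ofBits s g e k).s = s ∧ (ofBits s g e k).g = g ∧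
    (ofBits s g e k).e = e ∧ (ofBits s g e k).k = k := by
  cases s <;> cases g <;> cases e <;> cases k <;> decide

/-- The product of two basis elements: a list of signs (`true` for `-1`) and basis elements. -/
def table (x y : Mono) : List (Bool × Mono) :=
  bif Bool.xor x.s y.s then []
  else
    let sg := Bool.xor (x.k && Bool.xor y.g y.e) (x.k && y.k && x.s)
    let k := Bool.xor x.k y.k
    bif x.e && y.g then
      (bif x.s then [(sg, ofBits x.s x.g y.e k)] else []) ++
        bif x.g || y.e then [] else [(!sg, ofBits x.s true true k)]
    else bif (x.g && y.g) || (x.e && y.e) then []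
    else [(sg, ofBits x.s (x.g || y.g) (x.e || y.e) k)]

/-- The value of `f` at `n`, arranged so that `n` is evaluated before `f` is applied. -/
def force {X : Type} (n : ℕ) (f : ℕ → X) : X := Nat.rec (f 0) (fun k _ => f (Nat.succ k)) n

theorem force_eq {X : Type} (n : ℕ) (f : ℕ → X) : force n f = f n := by
  cases n <;> rfl

/-- The multiplication table, with evaluated arguments. -/
def mul (x y : Mono) : List (Bool × Mono) := force x fun x => force y fun y => table x y

theorem mul_eq (x y : Mono) : mul x y = table x y := by
  rw [mul, force_eq, force_eq]

end Mono

/-! ### Lists of coordinates -/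

section List

variable {X : Type}

variable {A B D : Type} [Ring A] [Algebra ℂ A] [Ring B] [Algebra ℂ B] [Ring D] [Algebra ℂ D]

/-- The element with given coordinates: the sum of `t (b m) (ev x)` over the coordinates `x`. -/
def listEval (b : Mono → A) (t : A →ₗ[ℂ] B →ₗ[ℂ] D) (ev : X → B) (l : List (Mono × X)) : D :=
  (l.map fun p => t (b p.1) (ev p.2)).sum

variable {b : Mono → A} {t : A →ₗ[ℂ] B →ₗ[ℂ] D} {ev : X → B} {c : Coef → ℂ}

theorem listEval_nil : listEval b t ev [] = 0 := rfl

theorem listEval_cons (p : Mono × X) (l : List (Mono × X)) :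
    listEval b t ev (p :: l) = t (b p.1) (ev p.2) + listEval b t ev l := by
  simp [listEval]

/-- The combination of the values `h m x` over the coordinates `x` with label `m`. -/
def linComb {Y : Type} [Code Y] (h : Mono → X → Y) (l : List (Mono × X)) : Y :=
  l.foldr (fun p acc => h p.1 p.2 + acc) 0

/-- Apply `f` to each coordinate. -/
def mapSnd {Y : Type} (f : X → Y) (l : List (Mono × X)) : List (Mono × Y) :=
  l.map fun p => (p.1, f p.2)

/-- By linearity a map is computed from its values on single terms, whose codes are then added up.
-/
theorem map_listEval {Y : Type} [Code Y] {D' : Type} [Ring D'] [Algebra ℂ D'] {ev' : Y → D'}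
    (h' : IsModel c ev') (L : D →ₗ[ℂ] D') (f : Mono → X → Y)
    (hf : ∀ m x, L (t (b m) (ev x)) = ev' (f m x)) (l : List (Mono × X)) :
    L (listEval b t ev l) = ev' (linComb f l) := by
  unfold linComb
  induction l with
  | nil => rw [listEval_nil, map_zero]; exact h'.zero.symm
  | cons p l ih => rw [listEval_cons, map_add, ih, hf, List.foldr_cons, h'.add]

/-- A map that leaves the first factor alone keeps all labels, so no terms have to be merged. -/
theorem map_listEval_mapSnd {Y : Type} {B' D' : Type} [Ring B'] [Algebra ℂ B'] [Ring D']
    [Algebra ℂ D'] {ev' : Y → B'} {t' : A →ₗ[ℂ] B' →ₗ[ℂ] D'} (L : D →ₗ[ℂ] D') (f : X → Y)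
    (hf : ∀ a x, L (t a (ev x)) = t' a (ev' (f x))) (l : List (Mono × X)) :
    L (listEval b t ev l) = listEval b t' ev' (mapSnd f l) := by
  unfold mapSnd
  induction l with
  | nil => simp [listEval_nil]
  | cons p l ih =>
    rw [listEval_cons, map_add, ih, hf, List.map_cons]
    simp [listEval]

variable [Code X]

/-- Add `x` to the coordinate with label `m`. -/
def insert (m : Mono) (x : X) : List (Mono × X) → List (Mono × X)
  | [] => [(m, x)]
  | p :: l => bif Nat.beq p.1 m then (m, p.2 + x) :: l else p :: insert m x l

/-- Apply `f` to the coordinate with label `m`. -/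
def update (m : Mono) (f : X → X) : List (Mono × X) → List (Mono × X)
  | [] => [(m, f 0)]
  | p :: l => bif Nat.beq p.1 m then (m, f p.2) :: l else p :: update m f l

instance : Code (List (Mono × X)) where
  zero := []
  -- The labels 0 and 8 will stand for e₀ and e₁, and 1 = e₀ + e₁.
  one := [((0 : ℕ), 1), ((8 : ℕ), 1)]
  add l l' := l.foldr (fun p acc => insert p.1 p.2 acc) l'
  neg l := l.map fun p => (p.1, -p.2)
  mulAdd s l l' acc := l.foldr (fun p acc => l'.foldr (fun q acc =>
    (Mono.mul p.1 q.1).foldr (fun r acc =>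
      update r.2 (Code.mulAdd (Bool.xor s r.1) p.2 q.2) acc) acc) acc) acc
  smul r l := l.map fun p => (p.1, r • p.2)
  isZero l := l.all fun p => Code.isZero p.2

theorem listEval_insert (h : IsModel c ev) (m : Mono) (x : X) (l : List (Mono × X)) :
    listEval b t ev (insert m x l) = t (b m) (ev x) + listEval b t ev l := by
  induction l with
  | nil => rfl
  | cons p l ih =>
    rw [insert]
    cases hs : Nat.beq p.1 m
    · rw [cond_false, listEval_cons, ih, listEval_cons]
      abel
    · rw [cond_true, listEval_cons, listEval_cons, h.add, map_add, Nat.eq_of_beq_eq_true hs]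
      abel

theorem listEval_add (h : IsModel c ev) (l l' : List (Mono × X)) :
    listEval b t ev (l + l') = listEval b t ev l + listEval b t ev l' := by
  change listEval b t ev (l.foldr (fun p acc => insert p.1 p.2 acc) l') = _
  induction l with
  | nil => simp [listEval_nil]
  | cons p l ih => rw [List.foldr_cons, listEval_insert h, ih, listEval_cons, add_assoc]

/-- The multiplication table computes products of the elements `b m`. -/
def IsTable (b : Mono → A) : Prop :=
  ∀ x y, b x * b y = ((Mono.mul x y).map fun r => signed r.1 (b r.2)).sum

/-- Since `f` adds a fixed `d`, a product term can be accumulated in place at its label. An absent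
label counts as the coordinate 0, which is why `update` appends `f 0`. -/
theorem listEval_update (h : IsModel c ev) (m : Mono) {f : X → X} {d : B}
    (hf : ∀ x, ev (f x) = ev x + d) (l : List (Mono × X)) :
    listEval b t ev (update m f l) = listEval b t ev l + t (b m) d := by
  induction l with
  | nil => rw [update, listEval_cons, hf, h.zero, listEval_nil, zero_add, zero_add, add_zero]
  | cons p l ih =>
    rw [update]
    cases hs : Nat.beq p.1 m
    · rw [cond_false, listEval_cons, ih, listEval_cons, add_assoc]
    · rw [cond_true, listEval_cons, listEval_cons, hf, map_add, Nat.eq_of_beq_eq_true hs]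
      abel

theorem signed_xor {M : Type*} [AddCommGroup M] (s s' : Bool) (x : M) :
    signed (Bool.xor s s') x = signed s (signed s' x) := by
  cases s <;> cases s' <;> simp [signed]

theorem signed_add {M : Type*} [AddCommGroup M] (s : Bool) (x y : M) :
    signed s (x + y) = signed s x + signed s y := by
  cases s
  · rfl
  · exact neg_add x y

theorem map_signed {M N : Type*} [AddCommGroup M] [Module ℂ M] [AddCommGroup N] [Module ℂ N]
    (f : M →ₗ[ℂ] N) (s : Bool) (x : M) : f (signed s x) = signed s (f x) := by
  cases s
  · rfl
  · exact map_neg f x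

/-- The induction step over tensor factors. Bilinearity of `t` expands a product of two lists into
terms t(b x · b y, d · d'); the first entry comes from the table, the second from the model one
level below. Scalar multiplication and ⊗ are the two pairings `t` needed. -/
theorem isModel_listEval (h : IsModel c ev) (hb : IsTable b)
    (hb1 : b 0 + b 8 = 1)
    (ht1 : t 1 1 = 1) (ht : ∀ a a' d d', t a d * t a' d' = t (a * a') (d * d')) :
    IsModel c (listEval b t ev) where
  zero := rfl
  one := by
    change listEval b t ev [(_, 1), (_, 1)] = 1
    rw [listEval_cons, listEval_cons, listEval_nil, h.one, add_zero, ← LinearMap.add_apply,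
      ← map_add, hb1, ht1]
  add := listEval_add h
  neg l := by
    change listEval b t ev (l.map fun p => (p.1, -p.2)) = _
    induction l with
    | nil => simp [listEval_nil]
    | cons p l ih => rw [List.map_cons, listEval_cons, ih, listEval_cons, h.neg, map_neg, neg_add]
  smul r l := by
    change listEval b t ev (l.map fun p => (p.1, r • p.2)) = _
    induction l with
    | nil => simp [listEval_nil]
    | cons p l ih =>
      rw [List.map_cons, listEval_cons, ih, listEval_cons, h.smul, map_smul, smul_add]
  isZero l hl := by
    change (l.all fun p => Code.isZero p.2) = true at hl
    induction l with
    | nil => rfl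
    | cons p l ih =>
      rw [List.all_cons, Bool.and_eq_true] at hl
      rw [listEval_cons, h.isZero _ hl.1, ih hl.2, map_zero, add_zero]
  mulAdd s l l' acc := by
    -- One pair of terms: its product has one contribution for each entry of the table.
    have aux : ∀ (x y : X) (rs : List (Bool × Mono)) (acc : List (Mono × X)),
        listEval b t ev (rs.foldr (fun r acc =>
          update r.2 (Code.mulAdd (Bool.xor s r.1) x y) acc) acc) =
          listEval b t ev acc +
            signed s (t (rs.map fun r => signed r.1 (b r.2)).sum (ev x * ev y)) := by
      intro x y rs acc
      induction rs with
      | nil => cases s <;> simp [signed]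
      | cons r rs ih =>
        rw [List.foldr_cons, listEval_update h _ (h.mulAdd (Bool.xor s r.1) x y), ih,
          List.map_cons, List.sum_cons, map_add, LinearMap.add_apply, signed_add, map_signed,
          signed_xor, map_signed, add_assoc, add_comm (signed s _)]
        congr 3
        cases r.1 <;> simp [signed]
    have aux2 : ∀ (p : Mono × X) (l' acc : List (Mono × X)),
        listEval b t ev (l'.foldr (fun q acc => (Mono.mul p.1 q.1).foldr (fun r acc =>
          update r.2 (Code.mulAdd (Bool.xor s r.1) p.2 q.2) acc) acc) acc) =
          listEval b t ev acc + signed s (t (b p.1) (ev p.2) * listEval b t ev l') := by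
      intro p l' acc
      induction l' with
      | nil => cases s <;> simp [listEval_nil, signed]
      | cons q l' ih =>
        rw [List.foldr_cons, aux, ih, listEval_cons, mul_add, ht, hb, signed_add, add_assoc,
          add_comm (signed s _)]
    change listEval b t ev (l.foldr (fun p acc => l'.foldr (fun q acc =>
      (Mono.mul p.1 q.1).foldr (fun r acc =>
        update r.2 (Code.mulAdd (Bool.xor s r.1) p.2 q.2) acc) acc) acc) acc) = _
    induction l with
    | nil => cases s <;> simp [listEval_nil, signed]
    | cons p l ih =>
      rw [List.foldr_cons, aux2, ih, listEval_cons, add_mul, signed_add, add_assoc,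
        add_comm (signed s _)]

end List

end SparseCode

namespace RestrictedSL2

open SparseCode QuasiHopf
open Complex (I)

/-! ### The basis of the quantum group -/

/-- The odd generator that is conjugate to `E`: `E * G + G * E = e1`. -/
noncomputable def G : Q := (-I) • (F * K)

theorem two_I_inv : (2 * I)⁻¹ = -I / 2 := by
  rw [mul_inv, Complex.inv_I]
  ring

theorem K_mul_K_pow : K * (K * (K * K)) = 1 := by
  rw [← K_pow]
  noncomm_ring

theorem Kinv_eq : Kinv = K * (K * K) := by
  calc Kinv = Kinv * (K * (K * (K * K))) := by rw [K_mul_K_pow, mul_one]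
    _ = K * (K * K) := by rw [← mul_assoc, Kinv_mul_K, one_mul]

theorem K_mul_G : K * G = -(G * K) := by
  simp only [G, mul_smul_comm, smul_mul_assoc, ← mul_assoc, K_mul_F, neg_mul, smul_neg]

theorem G_sq : G * G = 0 := by
  simp only [G, mul_smul_comm, smul_mul_assoc, mul_assoc, normalize, mul_neg, smul_zero,
    neg_zero]

/-- As K anticommutes with E, EG + GE = -i[E, F]K = -(K² - 1)/2. Thus E and G satisfy Clifford
relations on the e₁ component and anticommute on the e₀ component, and the scalar 1/(2i) has
disappeared. -/
theorem E_mul_G : E * G = e1 - G * E := by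
  have hI : I * I = -1 := Complex.I_mul_I
  have h : E * (F * K) = F * (E * K) + (-I / 2) • (K * K - 1) := by
    have := congrArg (· * K) E_mul_F
    simp only [sub_mul, smul_mul_assoc, Kinv_mul_K, two_I_inv, mul_assoc] at this
    rw [← this]
    abel
  have h2 : F * K * E = -(F * (E * K)) := by rw [mul_assoc, K_mul_E, mul_neg]
  simp only [G, mul_smul_comm, smul_mul_assoc, h, h2, e1, pow_two]
  have h3 : (-I) * (-I / 2) = -(1 / 2) := by linear_combination hI / 2
  rw [smul_add, smul_smul, h3]
  module

theorem e0_add_e1 : e0 + e1 = 1 := by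
  simp only [e0, e1]
  module

theorem e0_mul_e0 : e0 * e0 = e0 := by
  have h : (K ^ 2 * K ^ 2 : Q) = 1 := by rw [← pow_add, K_pow]
  simp only [e0, smul_mul_assoc, mul_smul_comm, mul_add, add_mul, h, mul_one, one_mul]
  module

theorem e1_eq : e1 = 1 - e0 := by rw [← e0_add_e1]; abel

theorem e0_mul_e1 : e0 * e1 = 0 := by rw [e1_eq, mul_sub, mul_one, e0_mul_e0, sub_self]

theorem e1_mul_e0 : e1 * e0 = 0 := by rw [e1_eq, sub_mul, one_mul, e0_mul_e0, sub_self]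

theorem e1_mul_e1 : e1 * e1 = e1 := by
  nth_rewrite 1 [e1_eq]
  rw [sub_mul, one_mul, e0_mul_e1, sub_zero]

theorem K_mul_K : K * K = e0 - e1 := by
  simp only [e0, e1, pow_two]
  module

theorem e0_mul_K : e0 * K = K * e0 := by
  simp only [e0, smul_mul_assoc, mul_smul_comm, add_mul, mul_add, pow_two, mul_assoc, mul_one,
    one_mul]

theorem e0_mul_E : e0 * E = E * e0 := by
  simp only [e0, smul_mul_assoc, mul_smul_comm, add_mul, mul_add, pow_two, mul_assoc, mul_one,
    one_mul, K_mul_E, mul_neg, normalize, neg_neg]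

theorem e0_mul_F : e0 * F = F * e0 := by
  simp only [e0, smul_mul_assoc, mul_smul_comm, add_mul, mul_add, pow_two, mul_assoc, mul_one,
    one_mul, K_mul_F, mul_neg, normalize, neg_neg]

theorem e0_mul_G : e0 * G = G * e0 := by
  simp only [G, smul_mul_assoc, mul_smul_comm, mul_assoc, ← e0_mul_K]
  rw [← mul_assoc, e0_mul_F, mul_assoc]

/-- The idempotent `e0` or `e1`. -/
noncomputable def idem (s : Bool) : Q := bif s then e1 else e0

/-- The product `G ^ g * E ^ e * K ^ k`. -/
noncomputable def word (g e k : Bool) : Q :=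
  (bif g then G else 1) * ((bif e then E else 1) * (bif k then K else 1))

/-- The basis of `Q` given by products of generators and central idempotents. -/
noncomputable def basisElt (m : Mono) : Q := word m.g m.e m.k * idem m.s

theorem idem_comm (s : Bool) {x : Q} (h : e0 * x = x * e0) : idem s * x = x * idem s := by
  cases s
  · exact h
  · simp only [idem, cond_true, e1_eq, mul_sub, sub_mul, mul_one, one_mul, h]

theorem e0_mul_word (g e k : Bool) : e0 * word g e k = word g e k * e0 := by
  unfold word
  cases g <;> cases e <;> cases k <;>
    simp only [cond_true, cond_false, mul_one, one_mul, e0_mul_G, e0_mul_E, e0_mul_K, mul_assoc,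
      (mul_assoc e0 _ _).symm]

theorem idem_mul_idem (s s' : Bool) : idem s * idem s' = bif xor s s' then 0 else idem s := by
  cases s <;> cases s' <;> simp [idem, e0_mul_e0, e0_mul_e1, e1_mul_e0, e1_mul_e1]

theorem basisElt_mul (x y : Mono) :
    basisElt x * basisElt y = word x.g x.e x.k * (word y.g y.e y.k * (idem x.s * idem y.s)) := by
  unfold basisElt
  rw [mul_assoc, ← mul_assoc (idem x.s), idem_comm _ (e0_mul_word _ _ _), mul_assoc]

/-- Rewriting rules that sort a right-associated product into the order G, E, K; the trailing factor
lets them act inside longer products. -/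
theorem normalize_basis (x : Q) :
    K * (E * x) = -(E * (K * x)) ∧ K * (G * x) = -(G * (K * x)) ∧
    E * (E * x) = 0 ∧ G * (G * x) = 0 ∧ E * (G * x) = e1 * x - G * (E * x) ∧
    K * (K * x) = e0 * x - e1 * x := by
  refine ⟨(normalize x).2.2.1, ?_, ?_, ?_, ?_, ?_⟩
  · rw [← mul_assoc, K_mul_G, neg_mul, mul_assoc]
  · rw [← mul_assoc, E_sq, zero_mul]
  · rw [← mul_assoc, G_sq, zero_mul]
  · rw [← mul_assoc, E_mul_G, sub_mul, mul_assoc]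
  · rw [← mul_assoc, K_mul_K, sub_mul]

theorem idem_move (x : Q) : e1 * (G * x) = G * (e1 * x) ∧ e1 * (E * x) = E * (e1 * x) ∧
    e1 * (K * x) = K * (e1 * x) ∧ e0 * (G * x) = G * (e0 * x) ∧ e0 * (E * x) = E * (e0 * x) ∧
    e0 * (K * x) = K * (e0 * x) := by
  have h1 := idem_comm true e0_mul_G
  have h2 := idem_comm true e0_mul_E
  have h3 := idem_comm true e0_mul_K
  simp only [idem, cond_true] at h1 h2 h3
  simp only [← mul_assoc, h1, h2, h3, e0_mul_G, e0_mul_E, e0_mul_K, and_self]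

theorem isTable_basisElt : IsTable basisElt := by
  intro x y
  rw [basisElt_mul, idem_mul_idem, Mono.mul_eq]
  unfold Mono.table
  -- Both sides depend only on the four lowest binary digits, so case analysis on eight Booleans
  -- covers all natural numbers as labels.
  generalize x.s = s, x.g = g, x.e = e, x.k = k, y.s = s', y.g = g', y.e = e', y.k = k'
  cases s <;> cases s' <;> dsimp only <;>
    simp only [Bool.xor_false, Bool.xor_true, Bool.not_false, Bool.not_true, cond_true, cond_false,
      mul_zero, List.map_nil, List.sum_nil] <;>
  cases g <;> cases e <;> cases k <;> cases g' <;> cases e' <;> cases k' <;>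
    simp only [word, basisElt, Mono.digits_ofBits, idem, signed, mul_assoc, cond_true, cond_false,
      one_mul, normalize_basis, idem_move, e0_mul_e0, e0_mul_e1, e1_mul_e0, e1_mul_e1, mul_neg,
      mul_zero,
      mul_sub, sub_zero, zero_sub, neg_neg, neg_zero, Bool.xor_false, Bool.xor_true, Bool.not_false,
      Bool.not_true, Bool.and_true, Bool.and_false, Bool.or_true,
      Bool.or_false, List.map_nil, List.map_cons, List.sum_nil, List.sum_cons, List.nil_append,
      List.cons_append, add_zero, neg_sub, ← sub_eq_add_neg, sub_self]
  all_goals abel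

/-! ### Coordinates in the tensor powers of the quantum group -/

/-- Coordinates in `Q`. -/
abbrev Code1 : Type := List (Mono × Coef)
/-- Coordinates in `Q ⊗ Q`. -/
abbrev Code2 : Type := List (Mono × Code1)
/-- Coordinates in `Q ⊗ Q ⊗ Q`. -/
abbrev Code3 : Type := List (Mono × Code2)
/-- Coordinates in `Q ⊗ Q ⊗ Q ⊗ Q`. -/
abbrev Code4 : Type := List (Mono × Code3)

section
variable (β : ℂ)

/-- At the innermost level the coordinates are scalars and the pairing is scalar multiplication;
every further level pairs by ⊗. -/
noncomputable def eval1 : Code1 → Q :=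
  listEval basisElt (LinearMap.lsmul ℂ Q).flip (Coef.eval β)
noncomputable def eval2 : Code2 → Q ⊗[ℂ] Q :=
  listEval basisElt (TensorProduct.mk ℂ Q Q) (eval1 β)
noncomputable def eval3 : Code3 → T3 Q :=
  listEval basisElt (TensorProduct.mk ℂ Q (Q ⊗[ℂ] Q)) (eval2 β)
noncomputable def eval4 : Code4 → T4 Q :=
  listEval basisElt (TensorProduct.mk ℂ Q (T3 Q)) (eval3 β)

end

theorem basisElt_zero : basisElt 0 = e0 := by
  have h : Mono.s 0 = false ∧ Mono.g 0 = false ∧ Mono.e 0 = false ∧ Mono.k 0 = false := by decide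
  simp [basisElt, word, idem, h]

theorem basisElt_eight : basisElt 8 = e1 := by
  have h : Mono.s 8 = true ∧ Mono.g 8 = false ∧ Mono.e 8 = false ∧ Mono.k 8 = false := by decide
  simp [basisElt, word, idem, h]

theorem basisElt_zero_add_basisElt_eight : basisElt 0 + basisElt 8 = 1 := by
  rw [basisElt_zero, basisElt_eight, e0_add_e1]

theorem isModel_tensor {β : ℂ} {X B : Type} [Code X] [Ring B] [Algebra ℂ B] {ev : X → B}
    (h : IsModel (Coef.eval β) ev) :
    IsModel (Coef.eval β) (listEval basisElt (TensorProduct.mk ℂ Q B) ev) :=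
  isModel_listEval h isTable_basisElt basisElt_zero_add_basisElt_eight rfl (by intros; simp)

theorem isModel1 {β : ℂ} (hβ : β ^ 4 = -1) : IsModel (Coef.eval β) (eval1 β) :=
  isModel_listEval (Coef.isModel hβ) isTable_basisElt basisElt_zero_add_basisElt_eight (by simp)
    (by intros; simp [smul_smul, mul_comm])

theorem isModel2 {β : ℂ} (hβ : β ^ 4 = -1) : IsModel (Coef.eval β) (eval2 β) :=
  isModel_tensor (isModel1 hβ)

theorem isModel3 {β : ℂ} (hβ : β ^ 4 = -1) : IsModel (Coef.eval β) (eval3 β) :=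
  isModel_tensor (isModel2 hβ)

theorem isModel4 {β : ℂ} (hβ : β ^ 4 = -1) : IsModel (Coef.eval β) (eval4 β) :=
  isModel_tensor (isModel3 hβ)

/-! ### Computing the structure maps on coordinates -/

/-- The basis element with label `m`. -/
def single {X : Type} [Code X] (m : Mono) : List (Mono × X) := [(m, 1)]

/-- Coordinates of `x ⊗ y`. -/
def tens {X : Type} [Code X] (x : Code1) (y : X) : List (Mono × X) := mapSnd (· • y) x

-- The precedence is that of `⊗ₜ`, so the formulas in coordinates parse exactly like those for Φ and
-- R.
infixl:100 " ⊠ " => tens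

/-- `f ⊗ id` followed by reassociation, for a map `f` given on basis elements. -/
def comulIdCode {X : Type} [Code X] (d : Mono → Code2) :
    List (Mono × X) → List (Mono × List (Mono × X)) :=
  linComb fun m x => mapSnd (· ⊠ x) (d m)

/-- Coordinates of the flipped tensor. -/
def swapCode {X : Type} [Code X] : List (Mono × List (Mono × X)) → List (Mono × List (Mono × X)) :=
  linComb fun m => linComb fun m' x => [(m', [(m, x)])]

/-- `id ⊗ f` on coordinates, for a linear functional `f` given on basis elements. -/
def counitIdCode {X : Type} [Code X] (f : Mono → Coef) : List (Mono × X) → X :=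
  linComb fun m x => f m • x

/-- A linear map given on basis elements. -/
def linCode (f : Mono → Code1) : Code1 → Code1 := linComb fun m x => x • f m

def sandwich₂Code (f : Mono → Code1) (c : Code1) (g : Mono → Code1) : Code2 → Code1 :=
  linComb fun m x => f m * (c * linCode g x)

def sandwich₃Code (f : Mono → Code1) (c : Code1) (g : Mono → Code1) (d : Code1)
    (h : Mono → Code1) : Code3 → Code1 :=
  linComb fun m x => f m * (c * sandwich₂Code g d h x)

section
variable {β : ℂ}

theorem listEval_tens {X B : Type} [Code X] [Ring B] [Algebra ℂ B] {ev : X → B}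
    (h : IsModel (Coef.eval β) ev) (x : Code1) (y : X) :
    listEval basisElt (TensorProduct.mk ℂ Q B) ev (x ⊠ y) = eval1 β x ⊗ₜ ev y := by
  refine (map_listEval_mapSnd ((TensorProduct.mk ℂ Q B).flip (ev y)) (· • y) ?_ x).symm
  intro a r
  simp [h.smul]

theorem eval2_tens (hβ : β ^ 4 = -1) (x y : Code1) :
    eval2 β (x ⊠ y) = eval1 β x ⊗ₜ eval1 β y := listEval_tens (isModel1 hβ) x y

theorem eval3_tens (hβ : β ^ 4 = -1) (x : Code1) (y : Code2) :
    eval3 β (x ⊠ y) = eval1 β x ⊗ₜ eval2 β y := listEval_tens (isModel2 hβ) x y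

/-- With `B` general, this covers Δ ⊗ id and Δ ⊗ id ⊗ id together. -/
theorem listEval_comulIdCode {X B : Type} [Code X] [Ring B] [Algebra ℂ B] {ev : X → B}
    (h : IsModel (Coef.eval β) ev) (Δ : Q →ₐ[ℂ] Q ⊗[ℂ] Q) (d : Mono → Code2)
    (hd : ∀ m, Δ (basisElt m) = eval2 β (d m)) (l : List (Mono × X)) :
    ((Algebra.TensorProduct.assoc ℂ ℂ ℂ Q Q B).toAlgHom.comp
      (Algebra.TensorProduct.map Δ (AlgHom.id ℂ B)))
        (listEval basisElt (TensorProduct.mk ℂ Q B) ev l) =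
      listEval basisElt (TensorProduct.mk ℂ Q (Q ⊗[ℂ] B))
        (listEval basisElt (TensorProduct.mk ℂ Q B) ev) (comulIdCode d l) := by
  refine map_listEval (isModel_tensor (isModel_tensor h))
    ((Algebra.TensorProduct.assoc ℂ ℂ ℂ Q Q B).toAlgHom.comp
      (Algebra.TensorProduct.map Δ (AlgHom.id ℂ B))).toLinearMap _ ?_ l
  intro m x
  have := map_listEval_mapSnd (b := basisElt) (t := TensorProduct.mk ℂ Q Q) (ev := eval1 β)
    (t' := TensorProduct.mk ℂ Q (Q ⊗[ℂ] B)) (ev' := listEval basisElt (TensorProduct.mk ℂ Q B) ev)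
    ((TensorProduct.assoc ℂ Q Q B).toLinearMap ∘ₗ (TensorProduct.mk ℂ (Q ⊗[ℂ] Q) B).flip (ev x))
    (· ⊠ x) (by intro a y; simp [listEval_tens h]) (d m)
  rw [← this]
  change (Algebra.TensorProduct.assoc ℂ ℂ ℂ Q Q B) (Δ (basisElt m) ⊗ₜ ev x) = _
  rw [hd]
  rfl

theorem comulId_eval2 (hβ : β ^ 4 = -1) {Δ : Q →ₐ[ℂ] Q ⊗[ℂ] Q} {d : Mono → Code2}
    (hd : ∀ m, Δ (basisElt m) = eval2 β (d m)) (l : Code2) :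
    comulId Δ (eval2 β l) = eval3 β (comulIdCode d l) :=
  listEval_comulIdCode (isModel1 hβ) Δ d hd l

theorem comulIdId_eval3 (hβ : β ^ 4 = -1) {Δ : Q →ₐ[ℂ] Q ⊗[ℂ] Q} {d : Mono → Code2}
    (hd : ∀ m, Δ (basisElt m) = eval2 β (d m)) (l : Code3) :
    comulIdId Δ (eval3 β l) = eval4 β (comulIdCode d l) :=
  listEval_comulIdCode (isModel2 hβ) Δ d hd l

/-- Applied repeatedly, this moves a map into any inner tensor factor. -/
theorem map_id_listEval {X Y B B' : Type} [Ring B] [Algebra ℂ B] [Ring B'] [Algebra ℂ B']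
    {ev : X → B} {ev' : Y → B'} (L : B →ₐ[ℂ] B') (f : X → Y) (h : ∀ x, L (ev x) = ev' (f x))
    (l : List (Mono × X)) :
    Algebra.TensorProduct.map (AlgHom.id ℂ Q) L (listEval basisElt (TensorProduct.mk ℂ Q B) ev l) =
      listEval basisElt (TensorProduct.mk ℂ Q B') ev' (mapSnd f l) :=
  map_listEval_mapSnd (Algebra.TensorProduct.map (AlgHom.id ℂ Q) L).toLinearMap f
    (by intro a x; simp [h]) l

theorem map_eval1 {D : Type} [Ring D] [Algebra ℂ D] {Y : Type} [Code Y]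
    {ev : Y → D} (h : IsModel (Coef.eval β) ev) (L : Q →ₗ[ℂ] D) (f : Mono → Y)
    (hf : ∀ m, L (basisElt m) = ev (f m)) (l : Code1) :
    L (eval1 β l) = ev (linComb (fun m x => x • f m) l) := by
  refine map_listEval h L _ ?_ l
  intro m x
  simp [hf, h.smul]

theorem eval1_single (hβ : β ^ 4 = -1) (m : Mono) : eval1 β (single m) = basisElt m := by
  have h := (Coef.isModel hβ).one
  change listEval _ _ _ [(m, 1)] = _
  rw [listEval_cons, listEval_nil, add_zero]
  simp [h]

theorem idComul_eval2 (hβ : β ^ 4 = -1) {Δ : Q →ₐ[ℂ] Q ⊗[ℂ] Q} {d : Mono → Code2}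
    (hd : ∀ m, Δ (basisElt m) = eval2 β (d m)) (l : Code2) :
    idComul Δ (eval2 β l) = eval3 β (mapSnd (linComb fun m x => x • d m) l) :=
  map_id_listEval Δ _ (fun x => map_eval1 (isModel2 hβ) Δ.toLinearMap d hd x) l

theorem idComulId_eval3 (hβ : β ^ 4 = -1) {Δ : Q →ₐ[ℂ] Q ⊗[ℂ] Q} {d : Mono → Code2}
    (hd : ∀ m, Δ (basisElt m) = eval2 β (d m)) (l : Code3) :
    idComulId Δ (eval3 β l) = eval4 β (mapSnd (comulIdCode d) l) :=
  map_id_listEval _ _ (comulId_eval2 hβ hd) l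

theorem idIdComul_eval3 (hβ : β ^ 4 = -1) {Δ : Q →ₐ[ℂ] Q ⊗[ℂ] Q} {d : Mono → Code2}
    (hd : ∀ m, Δ (basisElt m) = eval2 β (d m)) (l : Code3) :
    idIdComul Δ (eval3 β l) = eval4 β (mapSnd (mapSnd (linComb fun m x => x • d m)) l) :=
  map_id_listEval _ _ (idComul_eval2 hβ hd) l

theorem includeLeft_eval1 (hβ : β ^ 4 = -1) (x : Code1) :
    (Algebra.TensorProduct.includeLeft : Q →ₐ[ℂ] Q ⊗[ℂ] Q) (eval1 β x) = eval2 β (x ⊠ 1) := by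
  rw [eval2_tens hβ, (isModel1 hβ).one]
  rfl

theorem leg12_eval2 (hβ : β ^ 4 = -1) (l : Code2) :
    leg12 (eval2 β l) = eval3 β (mapSnd (· ⊠ 1) l) :=
  map_id_listEval _ _ (includeLeft_eval1 hβ) l

theorem tensorOne_eval3 (hβ : β ^ 4 = -1) (l : Code3) :
    tensorOne (eval3 β l) = eval4 β (mapSnd (mapSnd (· ⊠ 1)) l) :=
  map_id_listEval _ _ (leg12_eval2 hβ) l

theorem includeRight_eval1 (hβ : β ^ 4 = -1) (x : Code1) :
    (Algebra.TensorProduct.includeRight : Q →ₐ[ℂ] Q ⊗[ℂ] Q) (eval1 β x) = eval2 β (1 ⊠ x) := by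
  rw [eval2_tens hβ, (isModel1 hβ).one]
  rfl

theorem leg23_eval2 (hβ : β ^ 4 = -1) (l : Code2) :
    leg23 (eval2 β l) = eval3 β (1 ⊠ l) := by
  rw [eval3_tens hβ, (isModel1 hβ).one]
  rfl

theorem leg13_eval2 (hβ : β ^ 4 = -1) (l : Code2) :
    leg13 (eval2 β l) = eval3 β (mapSnd (1 ⊠ ·) l) :=
  map_id_listEval _ _ (includeRight_eval1 hβ) l

theorem oneTensor_eval3 (hβ : β ^ 4 = -1) (l : Code3) :
    oneTensor (eval3 β l) = eval4 β (1 ⊠ l) := by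
  refine Eq.trans ?_ (listEval_tens (isModel3 hβ) 1 l).symm
  rw [(isModel1 hβ).one]
  rfl

/-- The flip of `Q ⊗ Q` and the permutation 213 of the threefold power both exchange the two
outermost labels, so `swapCode` serves both. The other permutations are composites. -/
theorem flip_eval2 (hβ : β ^ 4 = -1) (l : Code2) :
    flip (eval2 β l) = eval2 β (swapCode l) := by
  refine map_listEval (isModel2 hβ) flip.toLinearMap _ ?_ l
  intro m x
  refine map_listEval (isModel2 hβ) (flip.toLinearMap ∘ₗ TensorProduct.mk ℂ Q Q (basisElt m))
    (fun m' x => [(m', [(m, x)])]) ?_ x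
  intro m' x
  simp [QuasiHopf.flip, eval2, eval1, listEval]

theorem perm213_eval3 (hβ : β ^ 4 = -1) (l : Code3) :
    perm213 (eval3 β l) = eval3 β (swapCode l) := by
  refine map_listEval (isModel3 hβ) perm213.toLinearMap _ ?_ l
  intro m x
  refine map_listEval (isModel3 hβ)
    (perm213.toLinearMap ∘ₗ TensorProduct.mk ℂ Q (Q ⊗[ℂ] Q) (basisElt m))
    (fun m' x => [(m', [(m, x)])]) ?_ x
  intro m' x
  simp [perm213, eval3, eval2, listEval]

theorem perm132_eval3 (hβ : β ^ 4 = -1) (l : Code3) :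
    perm132 (eval3 β l) = eval3 β (mapSnd swapCode l) :=
  map_id_listEval _ _ (flip_eval2 hβ) l

theorem perm231_eval3 (hβ : β ^ 4 = -1) (l : Code3) :
    perm231 (eval3 β l) = eval3 β (mapSnd swapCode (swapCode l)) := by
  rw [← perm132_eval3 hβ, ← perm213_eval3 hβ]
  rfl

theorem perm312_eval3 (hβ : β ^ 4 = -1) (l : Code3) :
    perm312 (eval3 β l) = eval3 β (swapCode (mapSnd swapCode l)) := by
  rw [← perm213_eval3 hβ, ← perm132_eval3 hβ]
  rfl

theorem idCounitId_eval3 (hβ : β ^ 4 = -1) {ε : Q →ₐ[ℂ] ℂ} {f : Mono → Coef}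
    (hf : ∀ m, ε (basisElt m) = Coef.eval β (f m)) (l : Code3) :
    idCounitId ε (eval3 β l) = eval2 β (mapSnd (counitIdCode f) l) := by
  refine map_id_listEval _ _ (fun x => ?_) l
  refine map_listEval (isModel1 hβ) ((Algebra.TensorProduct.lid ℂ Q).toAlgHom.comp
      (Algebra.TensorProduct.map ε (AlgHom.id ℂ Q))).toLinearMap _ ?_ x
  intro m x
  simp [hf, (isModel1 hβ).smul]

theorem sandwich₂_eval2 (hβ : β ^ 4 = -1) {f g : Q →ₗ[ℂ] Q} {fc gc : Mono → Code1}
    (hf : ∀ m, f (basisElt m) = eval1 β (fc m)) (hg : ∀ m, g (basisElt m) = eval1 β (gc m))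
    (c : Code1) (l : Code2) :
    sandwich₂ f (eval1 β c) g (eval2 β l) = eval1 β (sandwich₂Code fc c gc l) := by
  refine map_listEval (isModel1 hβ) _ _ ?_ l
  intro m x
  have h : g (eval1 β x) = eval1 β (linCode gc x) := map_eval1 (isModel1 hβ) g gc hg x
  simp [sandwich₂, (isModel1 hβ).mul, hf, h]

theorem sandwich₃_eval3 (hβ : β ^ 4 = -1) {f g h : Q →ₗ[ℂ] Q} {fc gc hc : Mono → Code1}
    (hf : ∀ m, f (basisElt m) = eval1 β (fc m)) (hg : ∀ m, g (basisElt m) = eval1 β (gc m))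
    (hh : ∀ m, h (basisElt m) = eval1 β (hc m)) (c d : Code1) (l : Code3) :
    sandwich₃ f (eval1 β c) g (eval1 β d) h (eval3 β l) =
      eval1 β (sandwich₃Code fc c gc d hc l) := by
  refine map_listEval (isModel1 hβ) _ _ ?_ l
  intro m x
  simp [sandwich₃, (isModel1 hβ).mul, hf, sandwich₂_eval2 hβ hg hh]

end

/-! ### Coordinates of the structure elements -/

def natCoef (n : ℕ) : Coef := .even 0 n 0

def halfCoef : Coef := .even 1 1 0

def betaCoef : Coef := .full 0 0 1 0 0

/-- The coefficient `β ^ 2` or `-β ^ 2`, one of which is the imaginary unit. -/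
def iCoef (σ : Bool) : Coef := .even 0 0 (bif σ then -1 else 1)

/-- The coefficient `i β ^ 2`, which is a sign. -/
def signCoef (σ : Bool) : Coef := .even 0 (bif σ then 1 else -1) 0

/-- The coordinates of `e0 + e1` multiplied by a word in the generators. -/
def wordCode (g e k : Bool) : Code1 := [(Mono.ofBits false g e k, 1), (Mono.ofBits true g e k, 1)]

def e0Code : Code1 := single 0

def e1Code : Code1 := single 8

def idemCode (s : Bool) : Code1 := single (Mono.ofBits s false false false)

def kCode : Code1 := wordCode false false true

def eCode : Code1 := wordCode false true false

def gCode : Code1 := wordCode true false false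

def kinvCode : Code1 := (e0Code - e1Code) * kCode

def fCode (σ : Bool) : Code1 := iCoef σ • (gCode * kinvCode)

/-- Coordinates of `Φ⁰¹⁰`. -/
def phi010 (σ : Bool) : Code3 :=
  1 ⊠ (1 ⊠ 1)
  - (1 + iCoef σ) • eCode ⊠ (kCode ⊠ fCode σ)
  + (1 - iCoef σ) • (fCode σ * kCode) ⊠ (kCode ⊠ (eCode * kCode))
  + natCoef 2 • (eCode * fCode σ * kCode) ⊠ (1 ⊠ (eCode * fCode σ * kCode))

/-- Coordinates of `Φ¹⁰¹`. -/
def phi101 (σ : Bool) : Code3 :=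
  (iCoef σ - 1) • 1 ⊠ (fCode σ ⊠ (eCode * kCode))
  + 1 ⊠ (kCode ⊠ 1)
  + natCoef 2 • 1 ⊠ ((eCode * fCode σ) ⊠ (eCode * fCode σ * kCode))
  - (1 + iCoef σ) • 1 ⊠ ((eCode * kCode) ⊠ fCode σ)
  - (1 + iCoef σ) • eCode ⊠ ((fCode σ * kCode) ⊠ 1)
  + (natCoef 2 * iCoef σ) • eCode ⊠ ((eCode * fCode σ * kCode) ⊠ fCode σ)
  + (1 - iCoef σ) • (fCode σ * kCode) ⊠ (eCode ⊠ 1)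
  - (natCoef 2 * iCoef σ) • (fCode σ * kCode) ⊠ ((eCode * fCode σ * kCode) ⊠ (eCode * kCode))
  - natCoef 2 • (eCode * fCode σ * kCode) ⊠ ((eCode * fCode σ) ⊠ 1)

/-- Coordinates of `Φ¹¹¹`. -/
def phi111 (σ : Bool) : Code3 :=
  signCoef σ •
    ((1 + iCoef σ) • 1 ⊠ (fCode σ ⊠ (eCode * kCode))
    - 1 ⊠ (kCode ⊠ 1)
    - natCoef 2 • 1 ⊠ ((eCode * fCode σ) ⊠ 1)
    - (natCoef 2 * iCoef σ) • 1 ⊠ ((eCode * fCode σ) ⊠ (eCode * fCode σ * kCode))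
    + (1 + iCoef σ) • 1 ⊠ ((eCode * kCode) ⊠ fCode σ)
    - (1 + iCoef σ) • eCode ⊠ (1 ⊠ fCode σ)
    + (1 + iCoef σ) • eCode ⊠ ((fCode σ * kCode) ⊠ 1)
    + (natCoef 2 * iCoef σ) • eCode ⊠ ((fCode σ * kCode) ⊠ (eCode * fCode σ * kCode))
    + natCoef 2 • eCode ⊠ ((eCode * fCode σ * kCode) ⊠ fCode σ)
    - (1 + iCoef σ) • (fCode σ * kCode) ⊠ (1 ⊠ (eCode * kCode))
    + (1 + iCoef σ) • (fCode σ * kCode) ⊠ (eCode ⊠ 1)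
    + (natCoef 2 * iCoef σ) • (fCode σ * kCode) ⊠ (eCode ⊠ (eCode * fCode σ * kCode))
    + natCoef 2 • (fCode σ * kCode) ⊠ ((eCode * fCode σ * kCode) ⊠ (eCode * kCode))
    + (natCoef 2 * iCoef σ) • (eCode * fCode σ * kCode) ⊠ (fCode σ ⊠ (eCode * kCode))
    + (natCoef 2 * iCoef σ) • (eCode * fCode σ * kCode) ⊠ (kCode ⊠ (eCode * fCode σ * kCode))
    - (natCoef 2 * iCoef σ) • (eCode * fCode σ * kCode) ⊠ ((eCode * fCode σ) ⊠ 1)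
    + (natCoef 2 * iCoef σ) • (eCode * fCode σ * kCode) ⊠ ((eCode * kCode) ⊠ fCode σ)
    + natCoef 4 • (eCode * fCode σ * kCode) ⊠ ((eCode * fCode σ) ⊠ (eCode * fCode σ * kCode)))

/-- Coordinates of `Φ`. -/
def phi (σ : Bool) : Code3 :=
  e0Code ⊠ (e0Code ⊠ e0Code)
  + e1Code ⊠ (e0Code ⊠ e0Code)
  + phi010 σ * e0Code ⊠ (e1Code ⊠ e0Code)
  + e0Code ⊠ (e0Code ⊠ e1Code)
  + e1Code ⊠ (e1Code ⊠ e0Code)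
  + phi101 σ * e1Code ⊠ (e0Code ⊠ e1Code)
  + e0Code ⊠ (e1Code ⊠ e1Code)
  + phi111 σ * e1Code ⊠ (e1Code ⊠ e1Code)

/-- Coordinates of `R⁰⁰`. -/
def r00 (σ : Bool) : Code2 :=
  halfCoef • (1 ⊠ 1 + 1 ⊠ kCode + kCode ⊠ 1 - kCode ⊠ kCode) *
    (1 ⊠ 1 + (natCoef 2 * iCoef σ) • eCode ⊠ fCode σ)

/-- Coordinates of `R⁰¹`. -/
def r01 (σ : Bool) : Code2 :=
  halfCoef • (1 ⊠ 1 - iCoef σ • 1 ⊠ kCode + kCode ⊠ 1 + iCoef σ • kCode ⊠ kCode) *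
    (1 ⊠ 1
      + (1 - iCoef σ) • (fCode σ * kCode) ⊠ (eCode * kCode)
      - (1 - iCoef σ) • eCode ⊠ fCode σ
      + (1 + iCoef σ) • (eCode * fCode σ * kCode) ⊠ 1
      + (natCoef 2 * iCoef σ) • (eCode * fCode σ * kCode) ⊠ (eCode * fCode σ * kCode))

/-- Coordinates of `R¹⁰`. -/
def r10 (σ : Bool) : Code2 :=
  halfCoef • (1 ⊠ 1 + 1 ⊠ kCode - iCoef σ • kCode ⊠ 1 + iCoef σ • kCode ⊠ kCode) *
    (1 ⊠ kCode
      + (1 - iCoef σ) • (fCode σ * kCode) ⊠ eCode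
      + (1 - iCoef σ) • eCode ⊠ (fCode σ * kCode)
      - (1 - iCoef σ) • 1 ⊠ (eCode * fCode σ)
      - (natCoef 2 * iCoef σ) • (eCode * fCode σ * kCode) ⊠ (eCode * fCode σ))

/-- Coordinates of `R¹¹`. -/
def r11 (σ : Bool) : Code2 :=
  (betaCoef * halfCoef) • (1 ⊠ 1 - iCoef σ • 1 ⊠ kCode - iCoef σ • kCode ⊠ 1 + kCode ⊠ kCode) *
    (-(iCoef σ • kCode ⊠ 1)
      + (natCoef 2 * iCoef σ) • (eCode * kCode) ⊠ fCode σ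
      + (1 - iCoef σ) • kCode ⊠ (eCode * fCode σ * kCode)
      - (1 + iCoef σ) • (eCode * fCode σ) ⊠ 1
      - (natCoef 2 * iCoef σ) • (eCode * fCode σ) ⊠ (eCode * fCode σ * kCode))

/-- Coordinates of `R`. -/
def rMat (σ : Bool) : Code2 :=
  r00 σ * e0Code ⊠ e0Code + r01 σ * e0Code ⊠ e1Code + r10 σ * e1Code ⊠ e0Code +
    r11 σ * e1Code ⊠ e1Code

/-- Coordinates of the comultiplication of a basis element. -/
def comulCode (m : Mono) : Code2 :=
  (bif m.g then 1 ⊠ gCode + gCode ⊠ kCode else 1) *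
    ((bif m.e then 1 ⊠ eCode + eCode ⊠ kCode else 1) * (bif m.k then kCode ⊠ kCode else 1)) *
    bif m.s then e0Code ⊠ e1Code + e1Code ⊠ e0Code else e0Code ⊠ e0Code + e1Code ⊠ e1Code

/-- The value of the counit on a basis element. -/
def counitCode (m : Mono) : Coef := bif m.g || m.e || m.s then 0 else 1

/-- Coordinates of the antipode of a basis element. -/
def antipodeCode (m : Mono) : Code1 :=
  idemCode m.s * (((bif m.k then kinvCode else 1) * (bif m.e then -(eCode * kinvCode) else 1)) *
    bif m.g then -(gCode * kinvCode) else 1)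

/-- Coordinates of the coevaluation element. -/
def coevalCode (σ : Bool) : Code1 :=
  e0Code - (natCoef 2 * signCoef σ) • ((fCode σ * eCode -
    (iCoef σ * (halfCoef * halfCoef)) • (kCode - kinvCode)) * e1Code)

/-- Coordinates of the inverse of the coassociator. -/
def phiInv (σ : Bool) : Code3 :=
  -- Multiplying this polynomial by Φ and subtracting 1 leaves (Φ⁴ - 1)(Φ - 1)², which vanishes.
  natCoef 2 • 1 - phi σ + phi σ * (phi σ * phi σ) * ((1 - phi σ) * (1 - phi σ))

/-- Coordinates of the inverse of the R-matrix. -/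
def rMatInv (σ : Bool) : Code2 :=
  -- The central idempotent e₁ ⊗ e₁ splits the problem. Off it the inverse comes from (R - 1)(R² -
  -- 1)² = 0, on it from (R⁴ + 1)(β²R² - 1) = 0.
  (1 - e1Code ⊠ e1Code) * (1 + (natCoef 2 • 1 - rMat σ * rMat σ) * rMat σ +
      rMat σ * rMat σ * (rMat σ * rMat σ - natCoef 2 • 1)) +
    e1Code ⊠ e1Code * rMat σ *
      ((betaCoef * betaCoef) • (1 + rMat σ * rMat σ * (rMat σ * rMat σ)) - rMat σ * rMat σ)

/-- Coordinates of the comultiplication of a generator. -/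
def comulGenCode (σ : Bool) : Gen → Code2
  | Gen.E => 1 ⊠ eCode + eCode ⊠ kCode
  | Gen.F => kinvCode ⊠ fCode σ + fCode σ ⊠ 1
  | Gen.K => kCode ⊠ kCode
  | Gen.Kinv => kinvCode ⊠ kinvCode

/-! ### Coordinates evaluate to the structure elements -/

section
variable {β : ℂ} {σ : Bool}

theorem eval_natCoef (n : ℕ) : Coef.eval β (natCoef n) = n := by simp [Coef.eval, natCoef]

theorem eval_halfCoef : Coef.eval β halfCoef = 1 / 2 := by simp [Coef.eval, halfCoef]

theorem eval_betaCoef : Coef.eval β betaCoef = β := by simp [Coef.eval, betaCoef]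

/-- If i = ±β², then iβ² = ±β⁴ = ∓1. -/
theorem eval_signCoef (hβ : β ^ 4 = -1) (hσ : Coef.eval β (iCoef σ) = I) :
    Coef.eval β (signCoef σ) = I * β ^ 2 := by
  rw [← hσ]
  cases σ <;> simp only [Coef.eval, signCoef, iCoef, cond_true, cond_false] <;> push_cast
  · linear_combination -hβ
  · linear_combination hβ

/-- β⁴ + 1 = (β² - i)(β² + i), so two cases cover all four values of β. -/
theorem exists_iCoef (hβ : β ^ 4 = -1) : ∃ σ, Coef.eval β (iCoef σ) = I := by
  have h : (β ^ 2 - I) * (β ^ 2 + I) = 0 := by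
    linear_combination hβ - Complex.I_mul_I
  rcases mul_eq_zero.1 h with h | h
  · exact ⟨false, by simp [Coef.eval, iCoef]; linear_combination h⟩
  · exact ⟨true, by simp [Coef.eval, iCoef]; linear_combination -h⟩

theorem eval1_idemCode (hβ : β ^ 4 = -1) (s : Bool) : eval1 β (idemCode s) = idem s := by
  rw [idemCode, eval1_single hβ]
  simp [basisElt, word, Mono.digits_ofBits]

theorem eval1_e0Code (hβ : β ^ 4 = -1) : eval1 β e0Code = e0 := eval1_idemCode hβ false

theorem eval1_e1Code (hβ : β ^ 4 = -1) : eval1 β e1Code = e1 := eval1_idemCode hβ true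

theorem eval1_wordCode (hβ : β ^ 4 = -1) (g e k : Bool) :
    eval1 β (wordCode g e k) = word g e k := by
  have h := (Coef.isModel hβ).one
  simp only [eval1, wordCode, listEval_cons, listEval_nil, h, add_zero]
  simp [basisElt, Mono.digits_ofBits, idem, ← mul_add, e0_add_e1]

theorem eval1_kCode (hβ : β ^ 4 = -1) : eval1 β kCode = K := by
  simp [kCode, eval1_wordCode hβ, word]

theorem eval1_eCode (hβ : β ^ 4 = -1) : eval1 β eCode = E := by
  simp [eCode, eval1_wordCode hβ, word]

theorem eval1_gCode (hβ : β ^ 4 = -1) : eval1 β gCode = G := by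
  simp [gCode, eval1_wordCode hβ, word]

theorem eval1_kinvCode (hβ : β ^ 4 = -1) : eval1 β kinvCode = Kinv := by
  rw [kinvCode, (isModel1 hβ).mul, (isModel1 hβ).sub, eval1_e0Code hβ, eval1_e1Code hβ,
    eval1_kCode hβ, ← K_mul_K, Kinv_eq, mul_assoc]

theorem eval1_fCode (hβ : β ^ 4 = -1) (hσ : Coef.eval β (iCoef σ) = I) :
    eval1 β (fCode σ) = F := by
  rw [fCode, (isModel1 hβ).smul, (isModel1 hβ).mul, eval1_gCode hβ, eval1_kinvCode hβ, hσ, G,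
    smul_mul_assoc, mul_assoc, K_mul_Kinv, mul_one, smul_smul]
  simp

/-- Evaluation of coordinates as a set of rewriting rules. -/
theorem eval_rules (hβ : β ^ 4 = -1) (hσ : Coef.eval β (iCoef σ) = I) :
    (∀ n, Coef.eval β (natCoef n) = n) ∧ Coef.eval β halfCoef = 1 / 2 ∧
    Coef.eval β betaCoef = β ∧ Coef.eval β (signCoef σ) = I * β ^ 2 ∧
    Coef.eval β (iCoef σ) = I ∧ Coef.eval β 1 = 1 ∧
    (∀ x y, Coef.eval β (x + y) = Coef.eval β x + Coef.eval β y) ∧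
    (∀ x y, Coef.eval β (x - y) = Coef.eval β x - Coef.eval β y) ∧
    (∀ x y, Coef.eval β (x * y) = Coef.eval β x * Coef.eval β y) ∧
    eval1 β e0Code = e0 ∧ eval1 β e1Code = e1 ∧ eval1 β kCode = K ∧ eval1 β eCode = E ∧
    eval1 β kinvCode = Kinv ∧ eval1 β (fCode σ) = F ∧ eval1 β 1 = 1 ∧
    (∀ x, eval1 β (-x) = -eval1 β x) ∧
    (∀ x y, eval1 β (x * y) = eval1 β x * eval1 β y) ∧
    (∀ x y, eval1 β (x - y) = eval1 β x - eval1 β y) ∧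
    (∀ r x, eval1 β (r • x) = Coef.eval β r • eval1 β x) ∧
    (∀ x y, eval2 β (x ⊠ y) = eval1 β x ⊗ₜ eval1 β y) ∧ eval2 β 1 = 1 ∧
    (∀ x, eval2 β (-x) = -eval2 β x) ∧
    (∀ x y, eval2 β (x + y) = eval2 β x + eval2 β y) ∧
    (∀ x y, eval2 β (x - y) = eval2 β x - eval2 β y) ∧
    (∀ x y, eval2 β (x * y) = eval2 β x * eval2 β y) ∧
    (∀ r x, eval2 β (r • x) = Coef.eval β r • eval2 β x) ∧
    (∀ x y, eval3 β (x ⊠ y) = eval1 β x ⊗ₜ eval2 β y) ∧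
    (∀ x y, eval3 β (x + y) = eval3 β x + eval3 β y) ∧
    (∀ x y, eval3 β (x - y) = eval3 β x - eval3 β y) ∧
    (∀ x y, eval3 β (x * y) = eval3 β x * eval3 β y) ∧
    (∀ r x, eval3 β (r • x) = Coef.eval β r • eval3 β x) :=
  have c := Coef.isModel hβ
  have m1 := isModel1 hβ
  have m2 := isModel2 hβ
  have m3 := isModel3 hβ
  ⟨eval_natCoef, eval_halfCoef, eval_betaCoef, eval_signCoef hβ hσ, hσ, c.one, c.add, c.sub, c.mul,
    eval1_e0Code hβ, eval1_e1Code hβ, eval1_kCode hβ, eval1_eCode hβ, eval1_kinvCode hβ,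
    eval1_fCode hβ hσ, m1.one, m1.neg, m1.mul, m1.sub, m1.smul, eval2_tens hβ, m2.one, m2.neg,
    m2.add, m2.sub, m2.mul, m2.smul, eval3_tens hβ, m3.add, m3.sub, m3.mul, m3.smul⟩

/-- The coordinate formulas copy the defining ones term by term, so pushing evaluation inwards makes
both sides literally equal. -/
theorem eval3_phi (hβ : β ^ 4 = -1) (hσ : Coef.eval β (iCoef σ) = I) :
    eval3 β (phi σ) = Phi β := by
  simp only [phi, phi010, phi101, phi111, Phi, Phi010, Phi101, Phi111, eval_rules hβ hσ,
    Nat.cast_ofNat]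

theorem eval2_rMat (hβ : β ^ 4 = -1) (hσ : Coef.eval β (iCoef σ) = I) :
    eval2 β (rMat σ) = RMat β := by
  simp only [rMat, r00, r01, r10, r11, RMat, R00, R01, R10, R11, mul_one_div, eval_rules hβ hσ,
    Nat.cast_ofNat]

theorem eval1_coevalCode (hβ : β ^ 4 = -1) (hσ : Coef.eval β (iCoef σ) = I) :
    eval1 β (coevalCode σ) = e0 - (2 * I * β ^ 2) • (Casimir * e1) := by
  have h : I * (1 / 2 * (1 / 2)) = I / 4 := by ring
  simp only [coevalCode, Casimir, eval_rules hβ hσ, Nat.cast_ofNat, h, mul_assoc]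

theorem eval2_comulGenCode (hβ : β ^ 4 = -1) (hσ : Coef.eval β (iCoef σ) = I) (x : Gen) :
    comulGen x = eval2 β (comulGenCode σ x) := by
  cases x <;> simp only [comulGen, comulGenCode, eval_rules hβ hσ]

/-- K² = e₀ - e₁ is group-like, so the idempotents multiply out like the characters' projections of
ℤ/2: the indices of the two factors add up to s. -/
theorem comulAlgHom_idem (s : Bool) : Bialgebra.comulAlgHom ℂ Q (idem s) =
    bif s then e0 ⊗ₜ e1 + e1 ⊗ₜ e0 else e0 ⊗ₜ e0 + e1 ⊗ₜ e1 := by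
  have h : Bialgebra.comulAlgHom ℂ Q (K ^ 2) = (e0 - e1) ⊗ₜ (e0 - e1) := by
    rw [map_pow, comulAlgHom_gen, pow_two, comulGen, Algebra.TensorProduct.tmul_mul_tmul, K_mul_K]
  have h1 : (1 : Q ⊗[ℂ] Q) = (e0 + e1) ⊗ₜ (e0 + e1) := by
    rw [e0_add_e1]
    rfl
  cases s
  · simp only [idem, cond_false]
    conv_lhs => rw [e0]
    rw [map_smul, map_add, map_one, h, h1]
    simp only [TensorProduct.tmul_add, TensorProduct.add_tmul, TensorProduct.tmul_sub,
      TensorProduct.sub_tmul]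
    module
  · simp only [idem, cond_true]
    conv_lhs => rw [e1]
    rw [map_smul, map_sub, map_one, h, h1]
    simp only [TensorProduct.tmul_add, TensorProduct.add_tmul, TensorProduct.tmul_sub,
      TensorProduct.sub_tmul]
    module

/-- The factor K cancels the K⁻¹ in Δ(F), so G has the same coproduct rule as E. -/
theorem comulAlgHom_G : Bialgebra.comulAlgHom ℂ Q G = 1 ⊗ₜ G + G ⊗ₜ K := by
  rw [G, map_smul, map_mul, comulAlgHom_gen, comulAlgHom_gen]
  simp only [comulGen, add_mul, Algebra.TensorProduct.tmul_mul_tmul, Kinv_mul_K, one_mul, smul_add,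
    TensorProduct.tmul_smul, ← TensorProduct.smul_tmul']

theorem comulAlgHom_basisElt (hβ : β ^ 4 = -1) (m : Mono) :
    Bialgebra.comulAlgHom ℂ Q (basisElt m) = eval2 β (comulCode m) := by
  have hE : Bialgebra.comulAlgHom ℂ Q E = 1 ⊗ₜ E + E ⊗ₜ K := comulAlgHom_gen Gen.E
  have hK : Bialgebra.comulAlgHom ℂ Q K = K ⊗ₜ K := comulAlgHom_gen Gen.K
  simp only [basisElt, word, comulCode, map_mul, comulAlgHom_idem, (isModel2 hβ).mul]
  congr 1
  · cases m.g <;> cases m.e <;> cases m.k <;>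
      simp only [cond_true, cond_false, hE, hK, comulAlgHom_G, map_one, (isModel2 hβ).one,
        (isModel2 hβ).add, eval2_tens hβ, eval1_gCode hβ, eval1_eCode hβ, eval1_kCode hβ,
        (isModel1 hβ).one]
  · cases m.s <;> simp only [cond_true, cond_false, (isModel2 hβ).add, eval2_tens hβ,
      eval1_e0Code hβ, eval1_e1Code hβ]

theorem counitAlgHom_basisElt (hβ : β ^ 4 = -1) (m : Mono) :
    Bialgebra.counitAlgHom ℂ Q (basisElt m) = Coef.eval β (counitCode m) := by
  have hE : Bialgebra.counitAlgHom ℂ Q E = 0 := counitAlgHom_gen Gen.E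
  have hF : Bialgebra.counitAlgHom ℂ Q F = 0 := counitAlgHom_gen Gen.F
  have hK : Bialgebra.counitAlgHom ℂ Q K = 1 := counitAlgHom_gen Gen.K
  have hG : Bialgebra.counitAlgHom ℂ Q G = 0 := by rw [G, map_smul, map_mul, hF]; simp
  have h0 : Bialgebra.counitAlgHom ℂ Q e0 = 1 := by
    rw [e0, map_smul, map_add, map_pow, hK, map_one, smul_eq_mul]; norm_num
  have h1 : Bialgebra.counitAlgHom ℂ Q e1 = 0 := by
    rw [e1, map_smul, map_sub, map_pow, hK, map_one]; simp
  have c := Coef.isModel hβ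
  simp only [basisElt, word, idem, counitCode, map_mul]
  cases m.s <;> cases m.g <;> cases m.e <;> cases m.k <;>
    simp only [cond_true, cond_false, hE, hK, hG, h0, h1, map_one, Bool.or_true, Bool.or_false,
      c.one, c.zero, mul_one, mul_zero]

theorem antipode_mul (a b : Q) : HopfAlgebra.antipode ℂ (a * b) =
    HopfAlgebra.antipode ℂ b * HopfAlgebra.antipode ℂ a :=
  antipodeMap_mul a b

theorem antipode_one : HopfAlgebra.antipode ℂ (1 : Q) = 1 := antipodeMap_one

theorem antipode_basisElt (hβ : β ^ 4 = -1) (m : Mono) :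
    HopfAlgebra.antipode ℂ (basisElt m) = eval1 β (antipodeCode m) := by
  have hE : HopfAlgebra.antipode ℂ E = -(E * Kinv) := antipode_gen Gen.E
  have hF : HopfAlgebra.antipode ℂ F = -(K * F) := antipode_gen Gen.F
  have hK : HopfAlgebra.antipode ℂ K = Kinv := antipode_gen Gen.K
  have hG : HopfAlgebra.antipode ℂ G = -(G * Kinv) := by
    rw [G, map_smul, antipode_mul, hF, hK, smul_mul_assoc, mul_assoc, K_mul_Kinv, mul_neg,
      ← mul_assoc, Kinv_mul_K, one_mul, mul_one, smul_neg]
  have hK2 : HopfAlgebra.antipode ℂ (K ^ 2) = K ^ 2 := by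
    rw [pow_two, antipode_mul, hK, Kinv_eq]
    calc K * (K * K) * (K * (K * K)) = K * (K * (K * K)) * (K * K) := by simp only [mul_assoc]
      _ = K * K := by rw [K_mul_K_pow, one_mul]
  have hs : ∀ s, HopfAlgebra.antipode ℂ (idem s) = idem s := by
    intro s
    cases s <;> simp only [idem, cond_true, cond_false, e0, e1, map_smul, map_add, map_sub, hK2,
      antipode_one]
  simp only [basisElt, word, antipodeCode, antipode_mul, hs, (isModel1 hβ).mul,
    eval1_idemCode hβ]
  congr 1
  cases m.g <;> cases m.e <;> cases m.k <;>
    simp only [cond_true, cond_false, hE, hK, hG, antipode_one, (isModel1 hβ).one,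
      (isModel1 hβ).neg, (isModel1 hβ).mul, eval1_gCode hβ, eval1_eCode hβ, eval1_kinvCode hβ]

end

/-! ### The identities in coordinates -/

/-- `Δ ⊗ id` on coordinates. -/
abbrev comulIdC {X : Type} [Code X] : List (Mono × X) → List (Mono × List (Mono × X)) :=
  comulIdCode comulCode

/-- `Δ` on coordinates. -/
abbrev comulC : Code1 → Code2 := linComb fun m x => x • comulCode m

/-- The axioms of a quasi-triangular quasi-Hopf algebra in coordinates, for a coassociator `p` with
inverse `q`, an R-matrix `r` with inverse `t` and a coevaluation element `c`. -/
structure IsQuasiHopfCode (σ : Bool) (p q : Code3) (r t : Code2) (c : Code1) : Prop where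
  mul_inv : Code.isZero (p * q - 1) = true
  inv_mul : Code.isZero (q * p - 1) = true
  rMatrix_mul_inv : Code.isZero (r * t - 1) = true
  rMatrix_inv_mul : Code.isZero (t * r - 1) = true
  quasi_coassoc (x : Gen) : Code.isZero (comulIdC (comulGenCode σ x) * p -
    p * mapSnd comulC (comulGenCode σ x)) = true
  counital : Code.isZero (mapSnd (counitIdCode counitCode) p - 1) = true
  cocycle : Code.isZero (comulIdC p * mapSnd (mapSnd comulC) p -
    mapSnd (mapSnd (· ⊠ 1)) p * mapSnd comulIdC p * 1 ⊠ p) = true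
  quasi_cocomm (x : Gen) : Code.isZero (r * comulGenCode σ x -
    swapCode (comulGenCode σ x) * r) = true
  -- This hexagon is multiplied by Φ₂₃₁ on the left and Φ on the right, so the longer code of Φ⁻¹ is
  -- not needed.
  comulId_rMatrix : Code.isZero (mapSnd swapCode (swapCode p) * comulIdC r * p -
    mapSnd (1 ⊠ ·) r * mapSnd swapCode p * 1 ⊠ r) = true
  idComul_rMatrix : Code.isZero (mapSnd comulC r -
    swapCode (mapSnd swapCode p) * mapSnd (1 ⊠ ·) r * swapCode q * mapSnd (· ⊠ 1) r * p) = true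
  sandwich : Code.isZero (sandwich₃Code antipodeCode 1 single c antipodeCode p - 1) = true
  sandwich_inv : Code.isZero (sandwich₃Code single c antipodeCode 1 single q - 1) = true

-- All the computation specific to Φ, R and the coevaluation element is here: for each sign σ, and
-- for each generator where one occurs, the difference of the two sides is evaluated and all its
-- coordinates vanish. The coefficients are formal in β, so no value of β is chosen.
set_option maxHeartbeats 2000000 in
theorem isQuasiHopfCode (σ : Bool) :
    IsQuasiHopfCode σ (phi σ) (phiInv σ) (rMat σ) (rMatInv σ) (coevalCode σ) where
  mul_inv := by cases σ <;> decide +kernel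
  inv_mul := by cases σ <;> decide +kernel
  rMatrix_mul_inv := by cases σ <;> decide +kernel
  rMatrix_inv_mul := by cases σ <;> decide +kernel
  quasi_coassoc x := by cases σ <;> cases x <;> decide +kernel
  counital := by cases σ <;> decide +kernel
  cocycle := by cases σ <;> decide +kernel
  quasi_cocomm x := by cases σ <;> cases x <;> decide +kernel
  comulId_rMatrix := by cases σ <;> decide +kernel
  idComul_rMatrix := by cases σ <;> decide +kernel
  sandwich := by cases σ <;> decide +kernel
  sandwich_inv := by cases σ <;> decide +kernel

/-! ### Assembling the quasi-Hopf structure -/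

/-- A twisted intertwining relation between algebra homomorphisms out of `Q` holds if it holds on
the generators. -/
theorem mul_eq_mul_of_gen {B : Type} [Ring B] [Algebra ℂ B] {f g : Q →ₐ[ℂ] B} {x : B}
    (h : ∀ y, x * f (gen y) = g (gen y) * x) (a : Q) : x * f a = g a * x := by
  induction a using RestrictedSL2.induction with
  | h1 c => rw [AlgHom.commutes, AlgHom.commutes, Algebra.commutes]
  | hg y => exact h y
  | hm a b ha hb => rw [map_mul, map_mul, ← mul_assoc, ha, mul_assoc, hb, mul_assoc]
  | ha a b ha hb => rw [map_add, map_add, mul_add, add_mul, ha, hb]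

theorem R00_eq_RStandard : R00 = RStandard := by
  simp only [R00, RStandard, Finset.sum_range_succ, Finset.sum_range_zero, zero_add, mul_zero,
    mul_one, pow_zero, pow_one, one_smul, smul_mul_assoc, neg_one_smul, add_mul, sub_mul]
  congr 1
  abel

theorem RMat_mul_e0 (β : ℂ) : RMat β * e0 ⊗ₜ e0 = RStandard * e0 ⊗ₜ e0 := by
  simp only [RMat, add_mul, mul_assoc, Algebra.TensorProduct.tmul_mul_tmul, e0_mul_e0, e1_mul_e0,
    TensorProduct.tmul_zero, TensorProduct.zero_tmul, mul_zero, add_zero, R00_eq_RStandard]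

/-! ### Centrality of the coevaluation element and the antipode axioms -/

theorem Casimir_mul_gen (x : Gen) : Casimir * gen x = gen x * Casimir := by
  have hI : (2 * I)⁻¹ = -(I / 4) - I / 4 := by rw [two_I_inv]; ring
  cases x <;>
    simp only [Casimir, sub_mul, mul_sub, smul_mul_assoc, mul_smul_comm, mul_assoc, F_sq,
      K_mul_E, K_mul_F, Kinv_mul_E, Kinv_mul_F, K_mul_Kinv, Kinv_mul_K, normalize, mul_zero,
      F_mul_E, mul_neg, neg_neg, smul_sub, smul_neg, hI]
  · module
  · module

theorem e1_mul_gen (x : Gen) : e1 * gen x = gen x * e1 := by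
  have h : e0 * gen x = gen x * e0 := by
    cases x
    · exact e0_mul_E
    · exact e0_mul_F
    · exact e0_mul_K
    · change e0 * Kinv = Kinv * e0
      rw [Kinv_eq, ← mul_assoc, e0_mul_K, mul_assoc, ← mul_assoc e0, e0_mul_K, mul_assoc K e0,
        e0_mul_K]
      simp only [mul_assoc]
  rw [e1_eq, sub_mul, mul_sub, h, one_mul, mul_one]

/-- The Casimir element and the idempotents commute with the generators, hence with everything; the
scalar `c` is irrelevant. -/
theorem coevalElt_central (c : ℂ) (a : Q) :
    (e0 - c • (Casimir * e1)) * a = a * (e0 - c • (Casimir * e1)) := by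
  refine mul_eq_mul_of_gen (f := AlgHom.id ℂ Q) (g := AlgHom.id ℂ Q) (fun y => ?_) a
  have h := e1_mul_gen y
  have h0 : e0 = 1 - e1 := by rw [← e0_add_e1]; abel
  simp only [AlgHom.coe_id, id_eq, h0, sub_mul, mul_sub, one_mul, mul_one, h, smul_mul_assoc,
    mul_smul_comm, mul_assoc]
  rw [← mul_assoc Casimir, Casimir_mul_gen, mul_assoc]

/-- With α = 1 this is the Hopf antipode axiom. -/
theorem sandwich₂_antipode_left (a : Q) :
    sandwich₂ (HopfAlgebra.antipode ℂ) 1 LinearMap.id (Bialgebra.comulAlgHom ℂ Q a) =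
      Bialgebra.counitAlgHom ℂ Q a • (1 : Q) := by
  have h : sandwich₂ antipodeMap (1 : Q) LinearMap.id =
      LinearMap.mul' ℂ Q ∘ₗ antipodeMap.rTensor Q :=
    TensorProduct.ext' fun x y => by simp [sandwich₂]
  rw [← Algebra.algebraMap_eq_smul_one]
  exact (LinearMap.congr_fun h (comulHom a)).trans (antipode_comul_left a)

/-- A central element can be pulled out of the sum, leaving the Hopf antipode axiom. The particular
coevaluation element matters only for the two normalizations involving Φ and Φ⁻¹. -/
theorem sandwich₂_antipode_right {z : Q} (hz : ∀ a, z * a = a * z) (a : Q) :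
    sandwich₂ LinearMap.id z (HopfAlgebra.antipode ℂ) (Bialgebra.comulAlgHom ℂ Q a) =
      Bialgebra.counitAlgHom ℂ Q a • z := by
  have h : z * LinearMap.mul' ℂ Q (antipodeMap.lTensor Q (comulHom a)) =
      z * algebraMap ℂ Q (counitHom a) := by rw [antipode_comul_right]
  rw [← Algebra.commutes, ← Algebra.smul_def] at h
  have h2 : sandwich₂ LinearMap.id z antipodeMap =
      LinearMap.mulLeft ℂ z ∘ₗ LinearMap.mul' ℂ Q ∘ₗ antipodeMap.lTensor Q :=
    TensorProduct.ext' fun x y => by simp [sandwich₂, ← mul_assoc, hz]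
  exact (LinearMap.congr_fun h2 (comulHom a)).trans h

theorem eq_mul_of_conj {B : Type} [Ring B] {a b p q x y z w : B} (hpq : p * q = 1)
    (hba : b * a = 1) (h : a * x * p = y * z * w) : x = b * y * z * w * q := by
  have := congrArg (fun t => b * t * q) h
  simp only [mul_assoc, hpq, mul_one] at this
  rwa [← mul_assoc b a, hba, one_mul, ← mul_assoc, ← mul_assoc, ← mul_assoc] at this

/-! ### From identities in coordinates to the axioms in tensor powers of `Q` -/

namespace IsQuasiHopfCode
variable {β : ℂ} {σ : Bool} {p q : Code3} {r t : Code2} {c : Code1}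

theorem eval3_mul_inv (h : IsQuasiHopfCode σ p q r t c) (hβ : β ^ 4 = -1) :
    eval3 β p * eval3 β q = 1 := by
  rw [← (isModel3 hβ).mul, (isModel3 hβ).ext h.mul_inv, (isModel3 hβ).one]

theorem eval3_inv_mul (h : IsQuasiHopfCode σ p q r t c) (hβ : β ^ 4 = -1) :
    eval3 β q * eval3 β p = 1 := by
  rw [← (isModel3 hβ).mul, (isModel3 hβ).ext h.inv_mul, (isModel3 hβ).one]

theorem eval2_mul_inv (h : IsQuasiHopfCode σ p q r t c) (hβ : β ^ 4 = -1) :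
    eval2 β r * eval2 β t = 1 := by
  rw [← (isModel2 hβ).mul, (isModel2 hβ).ext h.rMatrix_mul_inv, (isModel2 hβ).one]

theorem eval2_inv_mul (h : IsQuasiHopfCode σ p q r t c) (hβ : β ^ 4 = -1) :
    eval2 β t * eval2 β r = 1 := by
  rw [← (isModel2 hβ).mul, (isModel2 hβ).ext h.rMatrix_inv_mul, (isModel2 hβ).one]

theorem comulId_comulAlgHom_mul (h : IsQuasiHopfCode σ p q r t c) (hβ : β ^ 4 = -1)
    (hσ : Coef.eval β (iCoef σ) = I) (a : Q) :
    comulId (Bialgebra.comulAlgHom ℂ Q) (Bialgebra.comulAlgHom ℂ Q a) * eval3 β p =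
      eval3 β p * idComul (Bialgebra.comulAlgHom ℂ Q) (Bialgebra.comulAlgHom ℂ Q a) := by
  have hΔ := comulAlgHom_basisElt hβ
  refine (mul_eq_mul_of_gen
    (f := (idComul (Bialgebra.comulAlgHom ℂ Q)).comp (Bialgebra.comulAlgHom ℂ Q))
    (g := (comulId (Bialgebra.comulAlgHom ℂ Q)).comp (Bialgebra.comulAlgHom ℂ Q))
    (fun y => ?_) a).symm
  rw [AlgHom.comp_apply, AlgHom.comp_apply, comulAlgHom_gen, eval2_comulGenCode hβ hσ,
    comulId_eval2 hβ hΔ, idComul_eval2 hβ hΔ, ← (isModel3 hβ).mul, ← (isModel3 hβ).mul]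
  exact ((isModel3 hβ).ext (h.quasi_coassoc y)).symm

theorem eval2_mul_comulAlgHom (h : IsQuasiHopfCode σ p q r t c) (hβ : β ^ 4 = -1)
    (hσ : Coef.eval β (iCoef σ) = I) (a : Q) :
    eval2 β r * Bialgebra.comulAlgHom ℂ Q a =
      QuasiHopf.flip (Bialgebra.comulAlgHom ℂ Q a) * eval2 β r := by
  refine mul_eq_mul_of_gen (f := Bialgebra.comulAlgHom ℂ Q)
    (g := QuasiHopf.flip.comp (Bialgebra.comulAlgHom ℂ Q)) (fun y => ?_) a
  rw [AlgHom.comp_apply, comulAlgHom_gen, eval2_comulGenCode hβ hσ, flip_eval2 hβ,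
    ← (isModel2 hβ).mul, ← (isModel2 hβ).mul]
  exact (isModel2 hβ).ext (h.quasi_cocomm y)

theorem comulId_eval2 (h : IsQuasiHopfCode σ p q r t c) (hβ : β ^ 4 = -1) :
    comulId (Bialgebra.comulAlgHom ℂ Q) (eval2 β r) =
      perm231 (eval3 β q) * leg13 (eval2 β r) * perm132 (eval3 β p) * leg23 (eval2 β r) *
        eval3 β q := by
  refine eq_mul_of_conj (a := perm231 (eval3 β p)) (h.eval3_mul_inv hβ) ?_ ?_
  -- Permuting tensor factors is an algebra homomorphism, so the permuted inverse is the inverse of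
  -- Φ₂₃₁.
  · rw [← map_mul, h.eval3_inv_mul hβ, map_one]
  · simp only [RestrictedSL2.comulId_eval2 hβ (comulAlgHom_basisElt hβ), perm231_eval3 hβ,
      perm132_eval3 hβ, leg13_eval2 hβ, leg23_eval2 hβ, ← (isModel3 hβ).mul]
    exact (isModel3 hβ).ext h.comulId_rMatrix

theorem idComul_eval2 (h : IsQuasiHopfCode σ p q r t c) (hβ : β ^ 4 = -1) :
    idComul (Bialgebra.comulAlgHom ℂ Q) (eval2 β r) =
      perm312 (eval3 β p) * leg13 (eval2 β r) * perm213 (eval3 β q) * leg12 (eval2 β r) *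
        eval3 β p := by
  simp only [RestrictedSL2.idComul_eval2 hβ (comulAlgHom_basisElt hβ), perm312_eval3 hβ,
    perm213_eval3 hβ, leg13_eval2 hβ, leg12_eval2 hβ, ← (isModel3 hβ).mul]
  exact (isModel3 hβ).ext h.idComul_rMatrix

theorem cocycle_eval3 (h : IsQuasiHopfCode σ p q r t c) (hβ : β ^ 4 = -1) :
    comulIdId (Bialgebra.comulAlgHom ℂ Q) (eval3 β p) *
        idIdComul (Bialgebra.comulAlgHom ℂ Q) (eval3 β p) =
      tensorOne (eval3 β p) * idComulId (Bialgebra.comulAlgHom ℂ Q) (eval3 β p) *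
        oneTensor (eval3 β p) := by
  have hΔ := comulAlgHom_basisElt hβ
  simp only [comulIdId_eval3 hβ hΔ, idIdComul_eval3 hβ hΔ, idComulId_eval3 hβ hΔ,
    tensorOne_eval3 hβ, oneTensor_eval3 hβ, ← (isModel4 hβ).mul]
  exact (isModel4 hβ).ext h.cocycle

theorem idCounitId_eval3 (h : IsQuasiHopfCode σ p q r t c) (hβ : β ^ 4 = -1) :
    idCounitId (Bialgebra.counitAlgHom ℂ Q) (eval3 β p) = 1 := by
  rw [RestrictedSL2.idCounitId_eval3 hβ (counitAlgHom_basisElt hβ), (isModel2 hβ).ext h.counital,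
    (isModel2 hβ).one]

theorem sandwich₃_eval3 (h : IsQuasiHopfCode σ p q r t c) (hβ : β ^ 4 = -1) :
    sandwich₃ (HopfAlgebra.antipode ℂ) 1 LinearMap.id (eval1 β c)
      (HopfAlgebra.antipode ℂ) (eval3 β p) = 1 := by
  have e := RestrictedSL2.sandwich₃_eval3 hβ (antipode_basisElt hβ) (g := LinearMap.id)
    (fun m => (eval1_single hβ m).symm) (antipode_basisElt hβ) 1 c p
  rwa [(isModel1 hβ).ext h.sandwich, (isModel1 hβ).one] at e

theorem sandwich₃_eval3_inv (h : IsQuasiHopfCode σ p q r t c) (hβ : β ^ 4 = -1) :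
    sandwich₃ LinearMap.id (eval1 β c) (HopfAlgebra.antipode ℂ) 1 LinearMap.id
      (eval3 β q) = 1 := by
  have e := RestrictedSL2.sandwich₃_eval3 hβ (f := LinearMap.id) (h := LinearMap.id)
    (fun m => (eval1_single hβ m).symm) (antipode_basisElt hβ)
    (fun m => (eval1_single hβ m).symm) c 1 q
  rwa [(isModel1 hβ).ext h.sandwich_inv, (isModel1 hβ).one] at e

/-- The Hopf structure of `Q` together with elements whose coordinates satisfy the axioms is a
quasi-triangular quasi-Hopf structure. -/
theorem exists_quasiHopf (h : IsQuasiHopfCode σ p q r t c) (hβ : β ^ 4 = -1)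
    (hσ : Coef.eval β (iCoef σ) = I) {d : ℂ} (hc : eval1 β c = e0 - d • (Casimir * e1)) :
    ∃ H : QuasiTriangularQuasiHopfAlgebra Q,
      H.comul = Bialgebra.comulAlgHom ℂ Q ∧ H.counit = Bialgebra.counitAlgHom ℂ Q ∧
      H.antipode = HopfAlgebra.antipode ℂ ∧ (H.coassociator : T3 Q) = eval3 β p ∧
      (H.rMatrix : Q ⊗[ℂ] Q) = eval2 β r ∧ H.evalElt = 1 ∧ H.coevalElt = eval1 β c :=
  ⟨{
    comul := Bialgebra.comulAlgHom ℂ Q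
    counit := Bialgebra.counitAlgHom ℂ Q
    coassociator := ⟨eval3 β p, eval3 β q, h.eval3_mul_inv hβ, h.eval3_inv_mul hβ⟩
    counit_comul := fun a => (congrArg (TensorProduct.lid ℂ Q)
      (Coalgebra.rTensor_counit_comul (R := ℂ) a)).trans (by simp)
    comul_counit := fun a => (congrArg (TensorProduct.rid ℂ Q)
      (Coalgebra.lTensor_counit_comul (R := ℂ) a)).trans (by simp)
    quasi_coassoc := fun a => by
      rw [Units.eq_mul_inv_iff_mul_eq]
      exact h.comulId_comulAlgHom_mul hβ hσ a
    coassociator_counital := h.idCounitId_eval3 hβ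
    cocycle := h.cocycle_eval3 hβ
    rMatrix := ⟨eval2 β r, eval2 β t, h.eval2_mul_inv hβ, h.eval2_inv_mul hβ⟩
    rMatrix_comul := h.eval2_mul_comulAlgHom hβ hσ
    comulId_rMatrix := h.comulId_eval2 hβ
    idComul_rMatrix := h.idComul_eval2 hβ
    antipode := HopfAlgebra.antipode ℂ
    evalElt := 1
    coevalElt := eval1 β c
    antipode_one := antipode_one
    antipode_mul := antipode_mul
    antipode_evalElt := sandwich₂_antipode_left
    coevalElt_antipode := sandwich₂_antipode_right (hc ▸ coevalElt_central d)
    sandwich_coassociator := h.sandwich₃_eval3 hβ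
    sandwich_coassociator_inv := h.sandwich₃_eval3_inv hβ }, rfl, rfl, rfl, rfl, rfl, rfl, rfl⟩

end IsQuasiHopfCode

theorem exists_quasiHopf {β : ℂ} (hβ : β ^ 4 = -1) :
    ∃ H : QuasiTriangularQuasiHopfAlgebra Q,
      H.comul = Bialgebra.comulAlgHom ℂ Q ∧ H.counit = Bialgebra.counitAlgHom ℂ Q ∧
      H.antipode = HopfAlgebra.antipode ℂ ∧ (H.coassociator : T3 Q) = Phi β ∧
      (H.rMatrix : Q ⊗[ℂ] Q) = RMat β ∧ H.evalElt = 1 ∧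
      H.coevalElt = e0 - (2 * I * β ^ 2) • (Casimir * e1) := by
  obtain ⟨σ, hσ⟩ := exists_iCoef hβ
  have hc := eval1_coevalCode hβ hσ
  rw [← eval3_phi hβ hσ, ← eval2_rMat hβ hσ, ← hc]
  exact (isQuasiHopfCode σ).exists_quasiHopf hβ hσ hc

end RestrictedSL2

theorem theorem2 (β : ℂ) (hβ : β ^ 4 = -1) :
    (∃ H : QuasiHopf.QuasiTriangularQuasiHopfAlgebra RestrictedSL2.Q,
      H.comul = Bialgebra.comulAlgHom ℂ RestrictedSL2.Q ∧
      H.counit = Bialgebra.counitAlgHom ℂ RestrictedSL2.Q ∧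
      H.antipode = HopfAlgebra.antipode ℂ ∧
      (H.coassociator : QuasiHopf.T3 RestrictedSL2.Q) = RestrictedSL2.Phi β ∧
      (H.rMatrix : RestrictedSL2.Q ⊗[ℂ] RestrictedSL2.Q) = RestrictedSL2.RMat β ∧
      H.evalElt = 1 ∧
      H.coevalElt = RestrictedSL2.e0 -
        (2 * Complex.I * β ^ 2) • (RestrictedSL2.Casimir * RestrictedSL2.e1)) ∧
    RestrictedSL2.R00 = RestrictedSL2.RStandard ∧
    RestrictedSL2.RMat β * RestrictedSL2.e0 ⊗ₜ RestrictedSL2.e0 =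
      RestrictedSL2.RStandard * RestrictedSL2.e0 ⊗ₜ RestrictedSL2.e0 :=
  ⟨RestrictedSL2.exists_quasiHopf hβ, RestrictedSL2.R00_eq_RStandard, RestrictedSL2.RMat_mul_e0 β⟩
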